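/- Let $d\ge 1$, let $\Omega\subset\mathbb R^d$ be a bounded domain with $C^2$ boundary, let $\omega\subset\Omega$ be open and nonempty, let $r>0$, let $B_r(0)$ be the closed ball of radius $r$ centred at $0$ in $L^2(\Omega)$, and let $\lambda_1$ be the first eigenvalue of $-\Delta$ on $\Omega$ with the homogeneous Dirichlet boundary condition. Write $\|\cdot\|$ for the norm of $L^2(\Omega)$. For $y_0\in L^2(\Omega)$ and $u\in L^2(\mathbb R^+;L^2(\Omega))$ let $y(\cdot;y_0,u)$ be the (weak) solution of $$\partial_t y-\Delta y=\chi_\omega u\ \text{ in }\Omega\times\mathbb R^+,\qquad y=0\ \text{ on }\partial\Omega\times\mathbb R^+,\qquad y(0)=y_0\ \text{ in }\Omega,$$ and let $e^{\Delta t}y_0=y(t;y_0,0)$. For $M\ge 0$ and $y_0\in L^2(\Omega)\setminus B_r(0)$ put $$T(M,y_0)=\inf\{t>0:\ \exists\,u\in L^2(\mathbb R^+;L^2(\Omega))\text{ with }\|u\|_{L^2(\mathbb R^+;L^2(\Omega))}\le M\text{ and }y(t;y_0,u)\in B_r(0)\},$$ $$T^*_{y_0}=\sup\{t>0:\ e^{\Delta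 t}y_0\notin B_r(0)\}.$$ **Theorem.** For all $M\ge 0$ and $y_0\in L^2(\Omega)\setminus B_r(0)$, the sets defining $T(M,y_0)$ and $T^*_{y_0}$ are nonempty and the latter is bounded above (so both numbers are well defined and finite). For each $M\ge 0$, $$|T(M,y_1)-T(M,y_2)|\le\frac{1}{\lambda_1 r}\,\|y_1-y_2\|\qquad\text{for all }y_1,y_2\in L^2(\Omega)\setminus B_r(0).$$ Moreover, $T(0,y_0)=T^*_{y_0}$ for each $y_0\in L^2(\Omega)\setminus B_r(0)$. -/

import Mathlib

open MeasureTheory Set Filter Topology TopologicalSpace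

namespace HeatTimeOptimal

/-- The Euclidean space `ℝᵈ`. -/
abbrev E (d : ℕ) : Type := EuclideanSpace ℝ (Fin d)

/-- `Ω` is a bounded domain (nonempty, open and connected) with a `C²` boundary: near each boundary
point `Ω` is the negativity set of a `C²` function whose differential does not vanish at that
point. -/
structure IsBoundedC2Domain {d : ℕ} (Ω : Opens (E d)) : Prop where
  isConnected : IsConnected (Ω : Set (E d))
  isBounded : Bornology.IsBounded (Ω : Set (E d))
  boundary : ∀ x ∈ frontier (Ω : Set (E d)), ∃ U : Set (E d), IsOpen U ∧ x ∈ U ∧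
    ∃ ρ : E d → ℝ, ContDiffOn ℝ 2 ρ U ∧ fderiv ℝ ρ x ≠ 0 ∧ ∀ z ∈ U, (z ∈ Ω ↔ ρ z < 0)

/-- The real Hilbert space `L²(Ω)`. -/
abbrev L2 {d : ℕ} (Ω : Opens (E d)) : Type :=
  Lp ℝ 2 ((volume : Measure (E d)).restrict (Ω : Set (E d)))

/-- The Hilbert space `L²(Ω; ℝᵈ)`, in which gradients live. -/
abbrev L2Vec {d : ℕ} (Ω : Opens (E d)) : Type :=
  Lp (E d) 2 ((volume : Measure (E d)).restrict (Ω : Set (E d)))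

/-- The pairs `(φ, ∇φ)` with `φ ∈ C_c^∞(Ω)`, as elements of `L²(Ω) × L²(Ω; ℝᵈ)`. -/
def testPairs {d : ℕ} (Ω : Opens (E d)) : Set (L2 Ω × L2Vec Ω) :=
  {p | ∃ φ : E d → ℝ, ContDiff ℝ ((⊤ : ℕ∞) : WithTop ℕ∞) φ ∧ HasCompactSupport φ ∧ tsupport φ ⊆ (Ω : Set (E d)) ∧
    (p.1 : E d → ℝ) =ᵐ[(volume : Measure (E d)).restrict (Ω : Set (E d))] φ ∧
    (p.2 : E d → E d) =ᵐ[(volume : Measure (E d)).restrict (Ω : Set (E d))] gradient φ}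

/-- The Sobolev space `H¹₀(Ω)`, the closure of `C_c^∞(Ω)` in `H¹(Ω)`, given as the set of the pairs
`(f, ∇f)` with `f ∈ H¹₀(Ω)` and `∇f` its weak gradient. -/
def H10 {d : ℕ} (Ω : Opens (E d)) : Set (L2 Ω × L2Vec Ω) :=
  closure (testPairs Ω)

/-- `l` is an eigenvalue of `-Δ` with the homogeneous Dirichlet boundary condition on `Ω`: there is
`f ≠ 0` in `H¹₀(Ω)` with `-Δ f = l f` weakly. -/
def IsDirichletEigenvalue {d : ℕ} (Ω : Opens (E d)) (l : ℝ) : Prop :=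
  ∃ p ∈ H10 Ω, p.1 ≠ 0 ∧ ∀ q ∈ H10 Ω, inner ℝ p.2 q.2 = l * inner ℝ p.1 q.1

/-- The first eigenvalue `λ₁` of `-Δ` with the homogeneous Dirichlet boundary condition on `Ω`. -/
noncomputable def firstEigenvalue {d : ℕ} (Ω : Opens (E d)) : ℝ :=
  sInf {l : ℝ | IsDirichletEigenvalue Ω l}

/-- `y` is the weak solution on `Ω × (0, ∞)` of `∂ₜ y - Δ y = F`, with `y = 0` on `∂Ω × (0, ∞)`
and `y(0) = y₀`: `y` lies in `C([0, ∞); L²(Ω)) ∩ L²_loc([0, ∞); H¹₀(Ω))` and, for every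
`φ ∈ H¹₀(Ω)` and `t ≥ 0`,
`⟨y(t), φ⟩ + ∫₀ᵗ ⟨∇y(s), ∇φ⟩ ds = ⟨y₀, φ⟩ + ∫₀ᵗ ⟨F(s), φ⟩ ds`.
Only the values of `y` on `[0, ∞)` and of `F` on `(0, ∞)` matter. -/
def IsHeatSolution {d : ℕ} (Ω : Opens (E d)) (y₀ : L2 Ω) (F : ℝ → L2 Ω) (y : ℝ → L2 Ω) : Prop :=
  ContinuousOn y (Ici 0) ∧ y 0 = y₀ ∧
  ∃ G : ℝ → L2Vec Ω,
    (∀ T : ℝ, 0 < T → MemLp G 2 (volume.restrict (Ioo 0 T))) ∧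
    (∀ᵐ t ∂(volume.restrict (Ioi (0 : ℝ))), (y t, G t) ∈ H10 Ω) ∧
    ∀ q ∈ H10 Ω, ∀ t : ℝ, 0 ≤ t →
      inner ℝ (y t) q.1 + ∫ s in (0 : ℝ)..t, inner ℝ (G s) q.2 =
        inner ℝ y₀ q.1 + ∫ s in (0 : ℝ)..t, inner ℝ (F s) q.1

/-- Multiplication by the characteristic function `χ_ω` on `L²(Ω)`. -/
noncomputable def chiMul {d : ℕ} {Ω : Opens (E d)} (ω : Opens (E d)) (f : L2 Ω) : L2 Ω :=
  ((Lp.memLp f).indicator ω.isOpen.measurableSet).toLp _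

/-- The space `L²(ℝ⁺; L²(Ω))` of controls. -/
abbrev Control {d : ℕ} (Ω : Opens (E d)) : Type :=
  Lp (L2 Ω) 2 ((volume : Measure ℝ).restrict (Ioi 0))

/-- The times `t > 0` for which some control `u` with `‖u‖ ≤ M` steers the solution of
`∂ₜ y - Δ y = χ_ω u`, `y(0) = y₀`, into the closed ball `B_r(0)` at time `t`. -/
def hittingTimes {d : ℕ} (Ω ω : Opens (E d)) (r M : ℝ) (y₀ : L2 Ω) : Set ℝ :=
  {t | 0 < t ∧ ∃ u : Control Ω, ‖u‖ ≤ M ∧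
    ∃ y : ℝ → L2 Ω, IsHeatSolution Ω y₀ (fun s => chiMul ω (u s)) y ∧
      y t ∈ Metric.closedBall (0 : L2 Ω) r}

/-- The minimal time `T(M, y₀)`. -/
noncomputable def minTime {d : ℕ} (Ω ω : Opens (E d)) (r M : ℝ) (y₀ : L2 Ω) : ℝ :=
  sInf (hittingTimes Ω ω r M y₀)

/-- The times `t > 0` with `e^{Δt} y₀ ∉ B_r(0)`, where `t ↦ e^{Δt} y₀` is the solution of the
homogeneous heat equation with Dirichlet boundary condition and initial state `y₀`. -/
def freeTimesOutside {d : ℕ} (Ω : Opens (E d)) (r : ℝ) (y₀ : L2 Ω) : Set ℝ :=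
  {t | 0 < t ∧ ∃ y : ℝ → L2 Ω, IsHeatSolution Ω y₀ (fun _ => 0) y ∧
    y t ∉ Metric.closedBall (0 : L2 Ω) r}

/-- `T*_{y₀} = sup {t > 0 : e^{Δt} y₀ ∉ B_r(0)}`. -/
noncomputable def freeTime {d : ℕ} (Ω : Opens (E d)) (r : ℝ) (y₀ : L2 Ω) : ℝ :=
  sSup (freeTimesOutside Ω r y₀)

end HeatTimeOptimal

/-! Let `a = ‖y₂ - y₁‖`. If a control steers `y₁` into the ball at time `t`, the same control
started from `y₂` arrives at a state differing by the free evolution of `y₂ - y₁`, hence of norm at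
most `r + a`. Switching the control off and waiting `τ = a / (λ₁ r)` brings the norm down to `exp
(-a / r) (r + a) ≤ r`, because `1 + x ≤ exp x`. So `T(M, y₂) ≤ T(M, y₁) + τ`
(`add_mem_hittingTimes`, `minTime_le_minTime_add`), and exchanging the two states gives the
Lipschitz bound. Without control the norm never increases, so the times outside the ball all precede
the hitting times, which gives `T(0, y₀) = T*`.

The decay rate comes from an orthonormal basis of Dirichlet eigenfunctions (`exists_eigenbasis`), in
which the free evolution is diagonal. Its series is a weak solution (`isWeakSolution_freeState`) and
the only one for zero source (`eq_freeState_of_isWeakSolution`). Controlled solutions need no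
uniqueness: they are built from a given one by `IsWeakSolution.add_homogeneous` and
`IsWeakSolution.concat`.

The basis comes from the spectral theorem for a compact operator. Compactness is Rellich's theorem,
proved by averaging over small cubes (`exists_finiteDimensional_approximation`). Positivity of `λ₁`
is Poincaré's inequality (`exists_forall_mem_H10_norm_fst_le`). Both rest on the `L²` estimate for
translates by the gradient. -/

namespace HeatTimeOptimal

/-! ### Series of orthogonal, not necessarily normalised, vectors -/

section OrthogonalSeries

variable {ι X : Type*} [NormedAddCommGroup X] [InnerProductSpace ℝ X] {w : ι → X}

theorem norm_sq_sum_smul_of_orthogonal (hw : Pairwise fun i j => inner ℝ (w i) (w j) = 0)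
    (a : ι → ℝ) (s : Finset ι) :
    ‖∑ i ∈ s, a i • w i‖ ^ 2 = ∑ i ∈ s, a i ^ 2 * ‖w i‖ ^ 2 := by
  classical
  rw [← real_inner_self_eq_norm_sq, sum_inner]
  refine Finset.sum_congr rfl fun i hi => ?_
  rw [inner_sum, Finset.sum_eq_single i]
  · rw [real_inner_smul_left, real_inner_smul_right, real_inner_self_eq_norm_sq]; ring
  · intro j _ hji
    rw [real_inner_smul_left, real_inner_smul_right, hw hji.symm]; ring
  · intro h; exact absurd hi h

variable [CompleteSpace X]

/-- The vectors may vanish, so the orthogonal family used is that of the lines they span. -/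
theorem summable_smul_of_orthogonal (hw : Pairwise fun i j => inner ℝ (w i) (w j) = 0)
    {a : ι → ℝ} (ha : Summable fun i => a i ^ 2 * ‖w i‖ ^ 2) : Summable fun i => a i • w i := by
  have hV : OrthogonalFamily ℝ (fun i => Submodule.span ℝ {w i})
      (fun i => (Submodule.span ℝ {w i}).subtypeₗᵢ) := by
    intro i j hij v u
    obtain ⟨c, hc⟩ := Submodule.mem_span_singleton.1 v.2
    obtain ⟨e, he⟩ := Submodule.mem_span_singleton.1 u.2
    change inner ℝ (v : X) (u : X) = 0
    rw [← hc, ← he, real_inner_smul_left, real_inner_smul_right, hw hij]; ring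
  have := (hV.summable_iff_norm_sq_summable
    (fun i => ⟨a i • w i, Submodule.smul_mem _ _ (Submodule.mem_span_singleton_self _)⟩)).2 (by
      refine ha.congr fun i => ?_
      simp [norm_smul, mul_pow])
  simpa using this

theorem norm_sq_tsum_smul_of_orthogonal (hw : Pairwise fun i j => inner ℝ (w i) (w j) = 0)
    {a : ι → ℝ} (ha : Summable fun i => a i ^ 2 * ‖w i‖ ^ 2) :
    ‖∑' i, a i • w i‖ ^ 2 = ∑' i, a i ^ 2 * ‖w i‖ ^ 2 := by
  have h1 := ((summable_smul_of_orthogonal hw ha).hasSum.norm).pow 2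
  simp_rw [norm_sq_sum_smul_of_orthogonal hw] at h1
  exact tendsto_nhds_unique h1 ha.hasSum

/-- By orthogonality the squared distance between two values is a scalar series dominated by `4 B i
^ 2 * ‖w i‖ ^ 2`, so dominated convergence applies. -/
theorem continuousOn_tsum_smul_of_orthogonal {S : Set ℝ}
    (hw : Pairwise fun i j => inner ℝ (w i) (w j) = 0)
    {a : ι → ℝ → ℝ} {B : ι → ℝ} (hB : Summable fun i => B i ^ 2 * ‖w i‖ ^ 2)
    (hc : ∀ i, ContinuousOn (a i) S) (hab : ∀ i, ∀ t ∈ S, |a i t| ≤ B i) :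
    ContinuousOn (fun t => ∑' i, a i t • w i) S := by
  have hs : ∀ t ∈ S, Summable fun i => a i t ^ 2 * ‖w i‖ ^ 2 := fun t ht =>
    hB.of_nonneg_of_le (fun i => by positivity) fun i =>
      mul_le_mul_of_nonneg_right (sq_le_sq' (abs_le.1 (hab i t ht)).1 (abs_le.1 (hab i t ht)).2)
        (by positivity)
  intro t ht
  have hle : ∀ i, ∀ s ∈ S, (a i s - a i t) ^ 2 * ‖w i‖ ^ 2 ≤ 4 * (B i ^ 2 * ‖w i‖ ^ 2) := by
    intro i s hs
    have h1 := abs_le.1 (hab i s hs)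
    have h2 := abs_le.1 (hab i t ht)
    have : (a i s - a i t) ^ 2 ≤ (2 * B i) ^ 2 := sq_le_sq' (by linarith) (by linarith)
    calc _ ≤ (2 * B i) ^ 2 * ‖w i‖ ^ 2 := mul_le_mul_of_nonneg_right this (by positivity)
      _ = _ := by ring
  have hd : ∀ s ∈ S, ‖(∑' i, a i s • w i) - ∑' i, a i t • w i‖ ^ 2
      = ∑' i, (a i s - a i t) ^ 2 * ‖w i‖ ^ 2 := by
    intro s hs'
    rw [← (summable_smul_of_orthogonal hw (hs s hs')).tsum_sub
      (summable_smul_of_orthogonal hw (hs t ht))]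
    simp_rw [← sub_smul]
    exact norm_sq_tsum_smul_of_orthogonal hw ((hB.mul_left 4).of_nonneg_of_le
      (fun i => by positivity) fun i => hle i s hs')
  have hlim : Tendsto (fun s => ∑' i, (a i s - a i t) ^ 2 * ‖w i‖ ^ 2) (𝓝[S] t)
      (𝓝 (∑' _ : ι, (0 : ℝ))) := by
    refine tendsto_tsum_of_dominated_convergence (hB.mul_left 4) (fun i => ?_) ?_
    · have : Tendsto (fun s => (a i s - a i t) ^ 2 * ‖w i‖ ^ 2) (𝓝[S] t)
          (𝓝 ((a i t - a i t) ^ 2 * ‖w i‖ ^ 2)) :=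
        (((hc i t ht).sub tendsto_const_nhds).pow 2).mul_const _
      simpa using this
    · filter_upwards [self_mem_nhdsWithin] with s hs' i
      rw [Real.norm_of_nonneg (by positivity)]
      exact hle i s hs'
  rw [tsum_zero] at hlim
  rw [ContinuousWithinAt, tendsto_iff_norm_sub_tendsto_zero]
  have h2 : Tendsto (fun s => ‖(∑' i, a i s • w i) - ∑' i, a i t • w i‖ ^ 2) (𝓝[S] t) (𝓝 0) :=
    hlim.congr' (by filter_upwards [self_mem_nhdsWithin] with s hs' using (hd s hs').symm)
  have h3 := h2.sqrt
  simpa using h3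

end OrthogonalSeries

/-! ### The free evolution as an eigenfunction series -/

section EigenbasisEvolution

section Auxiliary

/-- Tonelli for the extended norms; no pointwise summability is needed. -/
theorem integrable_tsum_of_summable_integral_norm {α ι : Type*} [MeasurableSpace α]
    {μ : Measure α} [Countable ι] {F : ι → α → ℝ}
    (hF : ∀ i, Integrable (F i) μ) (hsum : Summable fun i => ∫ a, ‖F i a‖ ∂μ)
    (hm : AEStronglyMeasurable (fun a => ∑' i, F i a) μ) :
    Integrable (fun a => ∑' i, F i a) μ := by
  refine ⟨hm, ?_⟩
  rw [hasFiniteIntegral_iff_enorm]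
  have hi : ∀ i, ∫⁻ a, ‖F i a‖ₑ ∂μ = ENNReal.ofReal (∫ a, ‖F i a‖ ∂μ) := fun i => by
    rw [ofReal_integral_eq_lintegral_ofReal (hF i).norm (ae_of_all _ fun _ => norm_nonneg _)]
    simp_rw [ofReal_norm]
  calc ∫⁻ a, ‖∑' i, F i a‖ₑ ∂μ ≤ ∫⁻ a, ∑' i, ‖F i a‖ₑ ∂μ :=
        lintegral_mono fun a => enorm_tsum_le_tsum_enorm
    _ = ∑' i, ∫⁻ a, ‖F i a‖ₑ ∂μ := lintegral_tsum fun i => (hF i).1.enorm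
    _ = ∑' i, ENNReal.ofReal (∫ a, ‖F i a‖ ∂μ) := by simp_rw [hi]
    _ < ⊤ := by
        rw [← ENNReal.ofReal_tsum_of_nonneg
          (fun i => integral_nonneg fun _ => norm_nonneg _) hsum]
        exact ENNReal.ofReal_lt_top

theorem integral_mul_exp_neg_mul (k t : ℝ) :
    ∫ s in (0 : ℝ)..t, k * Real.exp (-(k * s)) = 1 - Real.exp (-(k * t)) := by
  have hd : ∀ x ∈ uIcc 0 t, HasDerivAt (fun s => -Real.exp (-(k * s))) (k * Real.exp (-(k * x))) x := by
    intro x _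
    have h := (((hasDerivAt_id x).const_mul k).neg.exp).neg
    refine h.congr_deriv ?_
    simp; ring
  rw [intervalIntegral.integral_eq_sub_of_hasDerivAt hd
    ((by fun_prop : Continuous fun s => k * Real.exp (-(k * s))).intervalIntegrable _ _)]
  simp; ring

/-- A continuous solution of `a(t) + k ∫₀ᵗ a = a₀` is an exponential. -/
theorem eq_exp_mul_of_integral_equation {a : ℝ → ℝ} {k a₀ : ℝ} (ha : ContinuousOn a (Ici 0))
    (h : ∀ t, 0 ≤ t → a t + k * ∫ s in (0 : ℝ)..t, a s = a₀) {t : ℝ} (ht : 0 ≤ t) :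
    a t = Real.exp (-(k * t)) * a₀ := by
  have hint : ∀ x, 0 ≤ x → IntervalIntegrable a volume 0 x := fun x hx =>
    (ha.mono (by rw [uIcc_of_le hx]; exact Icc_subset_Ici_self)).intervalIntegrable
  have hda : ∀ x, 0 < x → HasDerivAt a (-(k * a x)) x := by
    intro x hx
    have hcx : ContinuousAt a x := ha.continuousAt (Ici_mem_nhds hx)
    have h1 : HasDerivAt (fun u => ∫ s in (0 : ℝ)..u, a s) (a x) x :=
      intervalIntegral.integral_hasDerivAt_right (hint x hx.le)
        ((ha.mono Ioi_subset_Ici_self).stronglyMeasurableAtFilter isOpen_Ioi x hx) hcx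
    have h2 := (h1.const_mul k).const_sub a₀
    refine h2.congr_of_eventuallyEq ?_
    filter_upwards [Ioi_mem_nhds hx] with u hu
    have := h u (le_of_lt hu)
    linarith
  -- Integrating factor. Differentiability is known only at positive times; at 0 continuity
  -- suffices.
  have hE : ∀ x ∈ Ioo 0 t, HasDerivAt (fun s => Real.exp (k * s) * a s) 0 x := by
    intro x hx
    have h1 := (((hasDerivAt_id x).const_mul k).exp).mul (hda x hx.1)
    refine h1.congr_deriv ?_
    simp; ring
  have hcont : ContinuousOn (fun s => Real.exp (k * s) * a s) (Icc 0 t) :=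
    (by fun_prop : Continuous fun s => Real.exp (k * s)).continuousOn.mul
      (ha.mono Icc_subset_Ici_self)
  have h3 := intervalIntegral.integral_eq_sub_of_hasDerivAt_of_le ht hcont hE
    intervalIntegrable_const
  have h0 : a 0 = a₀ := by simpa using h 0 le_rfl
  simp only [intervalIntegral.integral_zero, mul_zero, Real.exp_zero, one_mul, h0] at h3
  have h4 : Real.exp (k * t) * a t = a₀ := by linarith
  rw [← h4, ← mul_assoc, ← Real.exp_add]
  simp

end Auxiliary

variable {H K ι : Type*} [NormedAddCommGroup H] [InnerProductSpace ℝ H]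
  [NormedAddCommGroup K] [InnerProductSpace ℝ K]

/-- An orthonormal basis of `H` formed by the eigenvectors of the form `⟨p.2, q.2⟩` on the space
`V` of pairs. -/
structure Eigenbasis (V : Submodule ℝ (H × K)) (ι : Type*) where
  basis : HilbertBasis ι ℝ H
  grad : ι → K
  eigenvalue : ι → ℝ
  mem : ∀ i, (basis i, grad i) ∈ V
  inner_grad : ∀ i, ∀ q ∈ V, inner ℝ (grad i) q.2 = eigenvalue i * inner ℝ (basis i) q.1

namespace Eigenbasis

variable {V : Submodule ℝ (H × K)} (e : Eigenbasis V ι)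

theorem norm_sq_grad (i : ι) : ‖e.grad i‖ ^ 2 = e.eigenvalue i := by
  rw [← real_inner_self_eq_norm_sq, e.inner_grad i _ (e.mem i), real_inner_self_eq_norm_sq,
    e.basis.orthonormal.1 i]
  simp

theorem eigenvalue_nonneg (i : ι) : 0 ≤ e.eigenvalue i := by
  rw [← e.norm_sq_grad]; positivity

theorem inner_basis_of_ne : Pairwise fun i j => inner ℝ (e.basis i) (e.basis j) = 0 :=
  fun _ _ hij => e.basis.orthonormal.2 hij

theorem inner_grad_of_ne : Pairwise fun i j => inner ℝ (e.grad i) (e.grad j) = 0 := by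
  intro i j hij
  rw [e.inner_grad i _ (e.mem j)]
  simp [e.inner_basis_of_ne hij]

theorem hasSum_sq_coeff (y : H) :
    HasSum (fun i => inner ℝ (e.basis i) y ^ 2) (‖y‖ ^ 2) := by
  have := e.basis.hasSum_inner_mul_inner y y
  rw [real_inner_self_eq_norm_sq] at this
  refine this.congr_fun ?_
  intro i
  rw [real_inner_comm, sq]

/-- The coefficients of the free evolution. -/
noncomputable def coeff (y : H) (i : ι) (t : ℝ) : ℝ :=
  Real.exp (-(e.eigenvalue i * t)) * inner ℝ (e.basis i) y

/-- The free evolution `t ↦ e^{-tA} y`. -/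
noncomputable def freeState (y : H) (t : ℝ) : H := ∑' i, e.coeff y i t • e.basis i

/-- The gradient of the free evolution. -/
noncomputable def freeGrad (y : H) (t : ℝ) : K := ∑' i, e.coeff y i t • e.grad i

theorem continuous_coeff (y : H) (i : ι) : Continuous (e.coeff y i) := by
  unfold coeff; fun_prop

/-- The spectral bound `m` is left free: `m = 0` gives contraction, a positive `m` gives decay. -/
theorem abs_coeff_le (y : H) (i : ι) {t m : ℝ} (ht : 0 ≤ t) (hm : m ≤ e.eigenvalue i) :
    |e.coeff y i t| ≤ Real.exp (-(m * t)) * |inner ℝ (e.basis i) y| := by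
  rw [coeff, abs_mul, Real.abs_exp]
  gcongr

theorem summable_coeff_basis (y : H) {t : ℝ} (ht : 0 ≤ t) :
    Summable fun i => e.coeff y i t ^ 2 * ‖e.basis i‖ ^ 2 := by
  refine (e.hasSum_sq_coeff y).summable.of_nonneg_of_le (fun i => by positivity) fun i => ?_
  have := e.abs_coeff_le y i ht (e.eigenvalue_nonneg i)
  simp only [zero_mul, neg_zero, Real.exp_zero, one_mul] at this
  rw [e.basis.orthonormal.1 i, one_pow, mul_one]
  exact sq_le_sq.2 this

/-- Parabolic smoothing: `x ≤ exp (2 x)` at `x = λ t`. It makes the gradient series converge at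
every positive time, whatever the initial state. -/
theorem coeff_sq_mul_eigenvalue_le (y : H) (i : ι) {t : ℝ} (ht : 0 < t) :
    e.coeff y i t ^ 2 * ‖e.grad i‖ ^ 2 ≤ t⁻¹ * inner ℝ (e.basis i) y ^ 2 := by
  rw [e.norm_sq_grad, coeff, mul_pow, ← Real.exp_nat_mul]
  have h0 := e.eigenvalue_nonneg i
  have h1 : e.eigenvalue i * t ≤ Real.exp (e.eigenvalue i * t * 2) := by
    have := Real.add_one_le_exp (e.eigenvalue i * t * 2)
    have : 0 ≤ e.eigenvalue i * t := by positivity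
    linarith
  have h2 : Real.exp ((2 : ℕ) * -(e.eigenvalue i * t)) * e.eigenvalue i ≤ t⁻¹ := by
    rw [show ((2 : ℕ) : ℝ) * -(e.eigenvalue i * t) = -(e.eigenvalue i * t * 2) by push_cast; ring,
      Real.exp_neg, inv_mul_le_iff₀ (Real.exp_pos _), ← div_eq_mul_inv, le_div_iff₀ ht]
    exact h1
  calc _ = (Real.exp ((2 : ℕ) * -(e.eigenvalue i * t)) * e.eigenvalue i) *
        inner ℝ (e.basis i) y ^ 2 := by ring
    _ ≤ _ := by gcongr

theorem summable_coeff_grad (y : H) {t : ℝ} (ht : 0 < t) :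
    Summable fun i => e.coeff y i t ^ 2 * ‖e.grad i‖ ^ 2 :=
  ((e.hasSum_sq_coeff y).summable.mul_left t⁻¹).of_nonneg_of_le (fun i => by positivity)
    fun i => e.coeff_sq_mul_eigenvalue_le y i ht

theorem freeState_zero (y : H) : e.freeState y 0 = y := by
  have := (e.basis.hasSum_repr y).tsum_eq
  simpa [freeState, coeff, e.basis.repr_apply_apply] using this

/-- The gradient may blow up at time 0, so domination is local: on `(t / 2, ∞)` by the coefficients
at `t / 2`. -/
theorem continuousOn_freeGrad [CompleteSpace K] (y : H) : ContinuousOn (e.freeGrad y) (Ioi 0) := by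
  intro t ht
  have ht' : t / 2 < t := half_lt_self ht
  have ht2 : 0 < t / 2 := half_pos ht
  have : ContinuousOn (e.freeGrad y) (Ioi (t / 2)) := by
    refine continuousOn_tsum_smul_of_orthogonal e.inner_grad_of_ne
      (B := fun i => |e.coeff y i (t / 2)|) ?_ (fun i => (e.continuous_coeff y i).continuousOn) ?_
    · simpa using e.summable_coeff_grad y ht2
    · intro i s hs
      simp only [coeff, abs_mul, Real.abs_exp]
      have := e.eigenvalue_nonneg i
      have := le_of_lt (mem_Ioi.1 hs)
      gcongr
  exact (this.continuousAt (Ioi_mem_nhds ht')).continuousWithinAt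

variable [CompleteSpace H]

theorem norm_freeState_le (y : H) {t m : ℝ} (ht : 0 ≤ t) (hm : ∀ i, m ≤ e.eigenvalue i) :
    ‖e.freeState y t‖ ≤ Real.exp (-(m * t)) * ‖y‖ := by
  refine le_of_sq_le_sq ?_ (by positivity)
  rw [freeState, norm_sq_tsum_smul_of_orthogonal e.inner_basis_of_ne (e.summable_coeff_basis y ht),
    mul_pow, ← (e.hasSum_sq_coeff y).tsum_eq, ← tsum_mul_left]
  refine (e.summable_coeff_basis y ht).tsum_le_tsum (fun i => ?_)
    ((e.hasSum_sq_coeff y).summable.mul_left _)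
  rw [e.basis.orthonormal.1 i, one_pow, mul_one, ← mul_pow]
  refine sq_le_sq.2 ((e.abs_coeff_le y i ht (hm i)).trans_eq ?_)
  rw [abs_mul, Real.abs_exp]

theorem continuousOn_freeState (y : H) : ContinuousOn (e.freeState y) (Ici 0) := by
  refine continuousOn_tsum_smul_of_orthogonal e.inner_basis_of_ne
    (B := fun i => |inner ℝ (e.basis i) y|) ?_ (fun i => (e.continuous_coeff y i).continuousOn) ?_
  · refine (e.hasSum_sq_coeff y).summable.congr fun i => ?_
    simp [e.basis.orthonormal.1 i]
  · intro i t ht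
    simpa using e.abs_coeff_le y i ht (e.eigenvalue_nonneg i)

/-- Partial sums lie in `V`, both components converge, and `V` is closed. -/
theorem freeState_mem [CompleteSpace K] (hV : IsClosed (V : Set (H × K))) (y : H) {t : ℝ} (ht : 0 < t) :
    (e.freeState y t, e.freeGrad y t) ∈ V := by
  have h1 := (summable_smul_of_orthogonal e.inner_basis_of_ne
    (e.summable_coeff_basis y ht.le)).hasSum
  have h2 := (summable_smul_of_orthogonal e.inner_grad_of_ne
    (e.summable_coeff_grad y ht)).hasSum
  refine hV.mem_of_tendsto (h1.prodMk h2) (Eventually.of_forall fun s => ?_)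
  exact V.sum_mem fun i _ => V.smul_mem _ (e.mem i)

end Eigenbasis

end EigenbasisEvolution

/-! ### Weak solutions: existence and uniqueness for zero source -/

section WeakSolutions

variable {H K ι : Type*} [NormedAddCommGroup H] [InnerProductSpace ℝ H]
  [NormedAddCommGroup K] [InnerProductSpace ℝ K]

/-- Weak solutions of `y' + A y = F`, `y(0) = y₀`, where `A` is the operator of the form
`⟨p.2, q.2⟩` on the space `V` of pairs. -/
def IsWeakSolution (V : Set (H × K)) (y₀ : H) (F : ℝ → H) (y : ℝ → H) : Prop :=
  ContinuousOn y (Ici 0) ∧ y 0 = y₀ ∧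
  ∃ G : ℝ → K,
    (∀ T : ℝ, 0 < T → MemLp G 2 (volume.restrict (Ioo 0 T))) ∧
    (∀ᵐ t ∂(volume.restrict (Ioi (0 : ℝ))), (y t, G t) ∈ V) ∧
    ∀ q ∈ V, ∀ t : ℝ, 0 ≤ t →
      inner ℝ (y t) q.1 + ∫ s in (0 : ℝ)..t, inner ℝ (G s) q.2 =
        inner ℝ y₀ q.1 + ∫ s in (0 : ℝ)..t, inner ℝ (F s) q.1

namespace Eigenbasis

variable {V : Submodule ℝ (H × K)} (e : Eigenbasis V ι)

theorem integral_eigenvalue_mul_coeff (y : H) (i : ι) {t : ℝ} :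
    ∫ s in (0 : ℝ)..t, e.eigenvalue i * e.coeff y i s
      = inner ℝ (e.basis i) y - e.coeff y i t := by
  simp only [coeff, ← mul_assoc]
  rw [intervalIntegral.integral_mul_const, integral_mul_exp_neg_mul]
  ring

/-- The energy identity of a single mode. -/
theorem integral_eigenvalue_mul_coeff_sq (y : H) (i : ι) {t : ℝ} :
    ∫ s in (0 : ℝ)..t, e.coeff y i s ^ 2 * ‖e.grad i‖ ^ 2
      = (inner ℝ (e.basis i) y ^ 2 - e.coeff y i t ^ 2) / 2 := by
  have h : ∀ s, e.coeff y i s ^ 2 * ‖e.grad i‖ ^ 2 =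
      2 * e.eigenvalue i * Real.exp (-(2 * e.eigenvalue i * s)) *
        (inner ℝ (e.basis i) y ^ 2 / 2) := fun s => by
    rw [coeff, e.norm_sq_grad, mul_pow, ← Real.exp_nat_mul]
    rw [show ((2 : ℕ) : ℝ) * -(e.eigenvalue i * s) = -(2 * e.eigenvalue i * s) by push_cast; ring]
    ring
  simp_rw [h]
  rw [intervalIntegral.integral_mul_const, integral_mul_exp_neg_mul, coeff, mul_pow,
    ← Real.exp_nat_mul]
  rw [show ((2 : ℕ) : ℝ) * -(e.eigenvalue i * t) = -(2 * e.eigenvalue i * t) by push_cast; ring]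
  ring

/-- Summed over the modes, the energy identity bounds the integral of `‖∇y‖²` by half of `‖y‖²`,
uniformly down to time 0. -/
theorem memLp_freeGrad [CompleteSpace K] [Countable ι] (y : H) {T : ℝ} (hT : 0 < T) :
    MemLp (e.freeGrad y) 2 (volume.restrict (Ioo 0 T)) := by
  have hm : AEStronglyMeasurable (e.freeGrad y) (volume.restrict (Ioo 0 T)) :=
    ((e.continuousOn_freeGrad y).mono Ioo_subset_Ioi_self).aestronglyMeasurable measurableSet_Ioo
  have hn : (fun s => ‖e.freeGrad y s‖ ^ 2) =ᵐ[volume.restrict (Ioo 0 T)]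
      fun s => ∑' i, e.coeff y i s ^ 2 * ‖e.grad i‖ ^ 2 := by
    filter_upwards [ae_restrict_mem measurableSet_Ioo] with s hs
    exact norm_sq_tsum_smul_of_orthogonal e.inner_grad_of_ne (e.summable_coeff_grad y hs.1)
  rw [memLp_two_iff_integrable_sq_norm hm, integrable_congr hn]
  have hc : ∀ i, Continuous fun s => e.coeff y i s ^ 2 * ‖e.grad i‖ ^ 2 := fun i => by
    have := e.continuous_coeff y i
    fun_prop
  refine integrable_tsum_of_summable_integral_norm
    (fun i => ((hc i).integrableOn_Icc (a := 0) (b := T)).mono_set Ioo_subset_Icc_self) ?_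
    ((hm.norm.pow 2).congr hn)
  refine ((e.hasSum_sq_coeff y).summable.div_const 2).of_nonneg_of_le
    (fun i => integral_nonneg fun _ => norm_nonneg _) fun i => ?_
  have h1 : ∀ s, ‖e.coeff y i s ^ 2 * ‖e.grad i‖ ^ 2‖ = e.coeff y i s ^ 2 * ‖e.grad i‖ ^ 2 :=
    fun s => Real.norm_of_nonneg (by positivity)
  simp_rw [h1]
  rw [← integral_Ioc_eq_integral_Ioo, ← intervalIntegral.integral_of_le hT.le,
    e.integral_eigenvalue_mul_coeff_sq]
  have : 0 ≤ e.coeff y i T ^ 2 := sq_nonneg _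
  linarith

theorem integral_inner_freeGrad [CompleteSpace H] [CompleteSpace K] [Countable ι] (y : H) {q : H × K}
    (hq : q ∈ V) {t : ℝ} (ht : 0 ≤ t) :
    ∫ s in (0 : ℝ)..t, inner ℝ (e.freeGrad y s) q.2
      = inner ℝ y q.1 - inner ℝ (e.freeState y t) q.1 := by
  set d : ι → ℝ := fun i => inner ℝ (e.basis i) q.1 with hd
  have hterm : ∀ s ∈ Ioc 0 t, inner ℝ (e.freeGrad y s) q.2
      = ∑' i, e.eigenvalue i * e.coeff y i s * d i := by
    intro s hs
    have h := (summable_smul_of_orthogonal e.inner_grad_of_ne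
      (e.summable_coeff_grad y hs.1)).hasSum.mapL (innerSL ℝ q.2)
    have h' := h.tsum_eq
    simp only [innerSL_apply_apply] at h'
    rw [freeGrad, real_inner_comm, ← h']
    refine tsum_congr fun i => ?_
    rw [real_inner_smul_right, real_inner_comm, e.inner_grad i q hq]
    ring
  have hstate : HasSum (fun i => e.coeff y i t * d i) (inner ℝ (e.freeState y t) q.1) := by
    have h := (summable_smul_of_orthogonal e.inner_basis_of_ne
      (e.summable_coeff_basis y ht)).hasSum.mapL (innerSL ℝ q.1)
    simp only [innerSL_apply_apply, real_inner_smul_right] at h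
    rw [real_inner_comm]
    refine h.congr_fun fun i => ?_
    rw [real_inner_comm]
  have hinit : HasSum (fun i => inner ℝ (e.basis i) y * d i) (inner ℝ y q.1) := by
    refine (e.basis.hasSum_inner_mul_inner y q.1).congr_fun fun i => ?_
    rw [real_inner_comm]
  have hi : ∀ i, ∫ s in (0 : ℝ)..t, e.eigenvalue i * e.coeff y i s * d i
      = inner ℝ (e.basis i) y * d i - e.coeff y i t * d i := fun i => by
    rw [intervalIntegral.integral_mul_const, e.integral_eigenvalue_mul_coeff, sub_mul]
  have hc : ∀ i, Continuous fun s => e.eigenvalue i * e.coeff y i s * d i := fun i => by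
    have := e.continuous_coeff y i
    fun_prop
  -- Sum and integral commute: each mode contributes at most `|⟨b i, y⟩ d i|` in absolute value, and
  -- the Parseval series converges absolutely.
  have hsum : HasSum (fun i => ∫ s in Ioc 0 t, e.eigenvalue i * e.coeff y i s * d i)
      (∫ s in Ioc 0 t, ∑' i, e.eigenvalue i * e.coeff y i s * d i) := by
    refine hasSum_integral_of_summable_integral_norm
      (fun i => ((hc i).integrableOn_Icc (a := 0) (b := t)).mono_set Ioc_subset_Icc_self) ?_
    refine hinit.summable.abs.of_nonneg_of_le
      (fun i => integral_nonneg fun _ => norm_nonneg _) fun i => ?_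
    have h1 : ∀ s, ‖e.eigenvalue i * e.coeff y i s * d i‖ =
        e.eigenvalue i * Real.exp (-(e.eigenvalue i * s)) * |inner ℝ (e.basis i) y * d i| := by
      intro s
      rw [coeff, Real.norm_eq_abs, mul_assoc, mul_assoc, abs_mul, abs_mul, Real.abs_exp,
        abs_of_nonneg (e.eigenvalue_nonneg i), mul_assoc]
    simp_rw [h1]
    rw [← intervalIntegral.integral_of_le ht, intervalIntegral.integral_mul_const,
      integral_mul_exp_neg_mul]
    have := Real.exp_pos (-(e.eigenvalue i * t))
    exact mul_le_of_le_one_left (abs_nonneg _) (by linarith)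
  rw [intervalIntegral.integral_of_le ht, setIntegral_congr_fun measurableSet_Ioc hterm]
  simp_rw [← intervalIntegral.integral_of_le ht, hi] at hsum
  rw [intervalIntegral.integral_of_le ht] at hsum
  exact hsum.unique (hinit.sub hstate)

theorem isWeakSolution_freeState [CompleteSpace H] [CompleteSpace K] [Countable ι]
    (hV : IsClosed (V : Set (H × K))) (y : H) :
    IsWeakSolution (V : Set (H × K)) y (fun _ => 0) (e.freeState y) := by
  refine ⟨e.continuousOn_freeState y, e.freeState_zero y, e.freeGrad y,
    fun T hT => e.memLp_freeGrad y hT, ?_, fun q hq t ht => ?_⟩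
  · filter_upwards [ae_restrict_mem measurableSet_Ioi] with t ht
    exact e.freeState_mem hV y ht
  · rw [e.integral_inner_freeGrad y hq ht]
    simp

/-- Testing with an eigenvector gives a scalar integral equation for each coefficient, solved only
by the exponential. The source need only vanish almost everywhere, so that the zero class of
controls is covered. -/
theorem eq_freeState_of_isWeakSolution {F y : ℝ → H} {y₀ : H}
    (hF : ∀ᵐ t ∂(volume.restrict (Ioi (0 : ℝ))), F t = 0)
    (h : IsWeakSolution (V : Set (H × K)) y₀ F y) {t : ℝ} (ht : 0 ≤ t) :
    y t = e.freeState y₀ t := by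
  obtain ⟨hc, h0, G, -, hG, hw⟩ := h
  have hcoeff : ∀ i, inner ℝ (e.basis i) (y t) = e.coeff y₀ i t := by
    intro i
    refine eq_exp_mul_of_integral_equation (a := fun s => inner ℝ (e.basis i) (y s))
      (continuousOn_const.inner hc) (fun s hs => ?_) ht
    have h1 := hw _ (e.mem i) s hs
    have hres : ∀ {P : ℝ → Prop}, (∀ᵐ t ∂(volume.restrict (Ioi (0 : ℝ))), P t) →
        ∀ᵐ t ∂(volume.restrict (Ioc 0 s)), P t := fun hP =>
      ae_restrict_of_ae_restrict_of_subset Ioc_subset_Ioi_self hP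
    have h2 : ∫ τ in (0 : ℝ)..s, inner ℝ (G τ) (e.grad i)
        = e.eigenvalue i * ∫ τ in (0 : ℝ)..s, inner ℝ (e.basis i) (y τ) := by
      rw [← intervalIntegral.integral_const_mul, intervalIntegral.integral_of_le hs,
        intervalIntegral.integral_of_le hs]
      refine integral_congr_ae ?_
      filter_upwards [hres hG] with τ hτ
      rw [real_inner_comm, e.inner_grad i _ hτ]
    have h3 : ∫ τ in (0 : ℝ)..s, inner ℝ (F τ) (e.basis i) = 0 := by
      rw [intervalIntegral.integral_of_le hs]
      refine integral_eq_zero_of_ae ?_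
      filter_upwards [hres hF] with τ hτ
      simp [hτ]
    simp only [h2, h3, add_zero] at h1
    rw [real_inner_comm, h1, real_inner_comm]
  have := (e.basis.hasSum_repr (y t)).tsum_eq
  simp_rw [e.basis.repr_apply_apply, hcoeff] at this
  exact this.symm

end Eigenbasis

end WeakSolutions

/-! ### Existence of the eigenbasis by the spectral theorem -/

section ExistenceOfEigenbasis

section Compactness

/-- An operator which is approximated by maps into finite-dimensional subspaces is compact. -/
theorem isCompactOperator_of_forall_exists_finiteDimensional {X H : Type*}
    [NormedAddCommGroup X] [NormedSpace ℝ X] [NormedAddCommGroup H] [InnerProductSpace ℝ H]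
    [CompleteSpace H] (f : X →L[ℝ] H)
    (h : ∀ δ : ℝ, 0 < δ → ∃ W : Submodule ℝ H, FiniteDimensional ℝ W ∧
      ∀ x, ∃ w ∈ W, ‖f x - w‖ ≤ δ * ‖x‖) : IsCompactOperator f := by
  have hpos : ∀ n : ℕ, (0 : ℝ) < 1 / ((n : ℝ) + 1) := fun n => Nat.one_div_pos_of_nat
  choose W hW happ using fun n : ℕ => h _ (hpos n)
  -- The approximants `w` need not depend linearly on `x`; orthogonal projections do, and are at
  -- least as close.
  refine isCompactOperator_of_tendsto (l := atTop)
    (F := fun n => ((W n).starProjection ∘L f)) ?_ (Eventually.of_forall fun n => ?_)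
  · rw [tendsto_iff_norm_sub_tendsto_zero]
    refine squeeze_zero (fun _ => norm_nonneg _) (fun n => ?_) tendsto_one_div_add_atTop_nhds_zero_nat
    refine ContinuousLinearMap.opNorm_le_bound _ (hpos n).le fun x => ?_
    obtain ⟨w, hw, hle⟩ := happ n x
    rw [sub_apply, norm_sub_rev, ContinuousLinearMap.comp_apply,
      Submodule.starProjection_minimal]
    refine le_trans (ciInf_le ⟨0, ?_⟩ (⟨w, hw⟩ : W n)) hle
    rintro _ ⟨_, rfl⟩
    exact norm_nonneg _
  · have := hW n
    have := FiniteDimensional.proper ℝ (W n)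
    have h1 : IsCompactOperator ((W n).subtypeL) := isCompactOperator_of_locallyCompactSpace_rng _
    exact h1.comp_clm ((W n).orthogonalProjectionOnto ∘L f)

end Compactness

section Countable

/-- Orthonormal vectors are `√2` apart, so balls of radius `1 / 2` about them are disjoint.
Countability serves to exchange sums and integrals. -/
theorem countable_of_orthonormal {H ι : Type*} [NormedAddCommGroup H] [InnerProductSpace ℝ H]
    [SeparableSpace H] {v : ι → H} (hv : Orthonormal ℝ v) : Countable ι := by
  have hd : ∀ i j, i ≠ j → 1 ≤ dist (v i) (v j) := by
    intro i j hij
    have : ‖v i - v j‖ ^ 2 = 2 := by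
      rw [norm_sub_sq_real, hv.1 i, hv.1 j, hv.2 hij]; norm_num
    rw [dist_eq_norm]
    nlinarith [norm_nonneg (v i - v j)]
  have : (univ : Set ι).PairwiseDisjoint fun i => Metric.ball (v i) (1 / 2) := by
    intro i _ j _ hij
    exact Metric.ball_disjoint_ball (by linarith [hd i j hij])
  exact countable_univ_iff.1 (this.countable_of_isOpen (fun _ _ => Metric.isOpen_ball)
    fun i _ => ⟨v i, Metric.mem_ball_self (by norm_num)⟩)

end Countable

variable {H K : Type*} [NormedAddCommGroup H] [InnerProductSpace ℝ H]
  [NormedAddCommGroup K] [InnerProductSpace ℝ K] [CompleteSpace H] [CompleteSpace K]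

/-- With the graph inner product `V` is a Hilbert space, and its projection `J` to `H` is compact.
Then `T = J J*`, in effect `(1 + A)⁻¹`, is compact, symmetric and, by density, injective. If `T b =
μ b`, the pair `μ⁻¹ J* b` has first component `b` and represents `μ⁻¹ ⟨b, ·⟩` in the graph inner
product, so `b` is an eigenvector for `μ⁻¹ - 1`. -/
theorem exists_eigenbasis {V : Submodule ℝ (H × K)} (hV : IsClosed (V : Set (H × K)))
    (hdense : ∀ f : H, (∀ p ∈ V, inner ℝ f p.1 = 0) → f = 0)
    (hcomp : ∀ δ : ℝ, 0 < δ → ∃ W : Submodule ℝ H, FiniteDimensional ℝ W ∧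
      ∀ p ∈ V, ∃ w ∈ W, ‖p.1 - w‖ ≤ δ * ‖p.2‖) :
    ∃ ι : Type, Nonempty (Eigenbasis V ι) := by
  -- The plain product carries the sup norm; `WithLp 2` supplies the inner product.
  let φ := WithLp.prodContinuousLinearEquiv 2 ℝ H K
  let V' : Submodule ℝ (WithLp 2 (H × K)) := V.comap (φ : WithLp 2 (H × K) →ₗ[ℝ] H × K)
  have hV' : IsClosed (V' : Set (WithLp 2 (H × K))) := hV.preimage φ.continuous
  have : CompleteSpace V' := hV'.completeSpace_coe
  have hsymm : ∀ q ∈ V, φ.symm q ∈ V' := fun q hq => by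
    change φ (φ.symm q) ∈ V
    rwa [φ.apply_symm_apply]
  let J : V' →L[ℝ] H := (WithLp.fstL 2 ℝ H K) ∘L V'.subtypeL
  have hJ : IsCompactOperator J := by
    refine isCompactOperator_of_forall_exists_finiteDimensional J fun δ hδ => ?_
    obtain ⟨W, hW, happ⟩ := hcomp δ hδ
    refine ⟨W, hW, fun x => ?_⟩
    obtain ⟨w, hw, hle⟩ := happ (φ x) x.2
    have hsnd : ‖(φ x).2‖ ≤ ‖x‖ := WithLp.norm_snd_le _ (x : WithLp 2 (H × K))
    exact ⟨w, hw, hle.trans (mul_le_mul_of_nonneg_left hsnd hδ.le)⟩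
  let T : H →L[ℝ] H := J ∘L J.adjoint
  have hT : IsCompactOperator T := hJ.comp_clm _
  have hinner : ∀ x y, inner ℝ (T x) y = inner ℝ (J.adjoint x) (J.adjoint y) := fun x y =>
    (ContinuousLinearMap.adjoint_inner_right J _ _).symm
  have hTs : (T : H →ₗ[ℝ] H).IsSymmetric := fun x y => by
    rw [ContinuousLinearMap.coe_coe, hinner, real_inner_comm, ← hinner, real_inner_comm]
  have hker : ∀ x, J.adjoint x = 0 → x = 0 := fun x hx => by
    refine hdense x fun p hp => ?_
    have := ContinuousLinearMap.adjoint_inner_left J (⟨φ.symm p, hsymm p hp⟩ : V') x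
    rw [hx, inner_zero_left] at this
    exact this.symm
  have hTinj : ∀ x, T x = 0 → x = 0 := fun x hx => by
    refine hker x (inner_self_eq_zero (𝕜 := ℝ) |>.1 ?_)
    rw [← hinner, hx, inner_zero_left]
  let Es : ℝ → Submodule ℝ H := fun μ => Module.End.eigenspace (T : Module.End ℝ H) μ
  have hfin : ∀ μ, FiniteDimensional ℝ (Es μ) := fun μ => by
    by_cases hμ : μ = 0
    · have : Es μ = ⊥ := by
        rw [Submodule.eq_bot_iff]
        intro x hx
        have hx' := Module.End.mem_eigenspace_iff.1 hx
        rw [hμ, zero_smul] at hx'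
        exact hTinj x hx'
      rw [this]; infer_instance
    · exact ContinuousLinearMap.finite_dimensional_eigenspace hT μ hμ
  let b : ∀ μ, OrthonormalBasis (Fin (Module.finrank ℝ (Es μ))) ℝ (Es μ) := fun μ =>
    stdOrthonormalBasis ℝ (Es μ)
  have hon : Orthonormal ℝ fun a : Σ μ : ℝ, Fin (Module.finrank ℝ (Es μ)) =>
      ((b a.1 a.2 : Es a.1) : H) :=
    hTs.orthogonalFamily_eigenspaces.orthonormal_sigma_orthonormal fun μ => (b μ).orthonormal
  have hbot : (Submodule.span ℝ (Set.range
      fun a : Σ μ : ℝ, Fin (Module.finrank ℝ (Es μ)) => ((b a.1 a.2 : Es a.1) : H)))ᗮ = ⊥ := by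
    rw [eq_bot_iff, ← ContinuousLinearMap.orthogonalComplement_iSup_eigenspaces_eq_bot hT hTs]
    refine Submodule.orthogonal_le (iSup_le fun μ x hx => ?_)
    have := (b μ).sum_repr ⟨x, hx⟩
    have h2 : x = ∑ i, (b μ).repr ⟨x, hx⟩ i • ((b μ i : Es μ) : H) := by
      conv_lhs => rw [show x = ((⟨x, hx⟩ : Es μ) : H) from rfl, ← this]
      simp
    rw [h2]
    exact Submodule.sum_mem _ fun i _ => Submodule.smul_mem _ _
      (Submodule.subset_span ⟨⟨μ, i⟩, rfl⟩)
  let B := HilbertBasis.mkOfOrthogonalEqBot hon hbot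
  have hB : ∀ a, B a = ((b a.1 a.2 : Es a.1) : H) := fun a => by
    simp only [B, HilbertBasis.coe_mkOfOrthogonalEqBot]
  have hTB : ∀ a, T (B a) = a.1 • B a := fun a => by
    rw [hB]
    exact Module.End.mem_eigenspace_iff.1 (b a.1 a.2).2
  have hne : ∀ a : Σ μ : ℝ, Fin (Module.finrank ℝ (Es μ)), a.1 ≠ 0 := fun a ha => by
    have h1 := hTB a
    rw [ha, zero_smul] at h1
    have h2 := B.orthonormal.1 a
    rw [hTinj _ h1] at h2
    simp at h2
  let P : (Σ μ : ℝ, Fin (Module.finrank ℝ (Es μ))) → V' := fun a => a.1⁻¹ • J.adjoint (B a)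
  have hP1 : ∀ a, (φ (P a)).1 = B a := fun a => by
    have : (φ (P a)).1 = J (P a) := rfl
    rw [this, map_smul]
    change a.1⁻¹ • T (B a) = B a
    rw [hTB, smul_smul, inv_mul_cancel₀ (hne a), one_smul]
  -- The `- 1` removes the `H` part of the graph inner product.
  refine ⟨_, ⟨{ basis := B, grad := fun a => (φ (P a)).2, eigenvalue := fun a => a.1⁻¹ - 1,
                mem := fun a => ?_, inner_grad := fun a q hq => ?_ }⟩⟩
  · rw [← hP1]
    exact (P a).2
  · have h1 : inner ℝ (P a) (⟨φ.symm q, hsymm q hq⟩ : V') = a.1⁻¹ * inner ℝ (B a) q.1 := by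
      refine (real_inner_smul_left (J.adjoint (B a)) _ _).trans ?_
      rw [ContinuousLinearMap.adjoint_inner_left]
      rfl
    have h2 : inner ℝ (P a) (⟨φ.symm q, hsymm q hq⟩ : V')
        = inner ℝ (φ (P a)).1 q.1 + inner ℝ (φ (P a)).2 q.2 :=
      WithLp.prod_inner_apply _ _
    rw [hP1] at h2
    linarith

end ExistenceOfEigenbasis

/-! ### Translation estimates and Poincaré's inequality -/

section Translations

theorem sq_lintegral_le {α : Type*} [MeasurableSpace α] {μ : Measure α} {f : α → ENNReal}
    (hf : AEMeasurable f μ) : (∫⁻ a, f a ∂μ) ^ 2 ≤ μ univ * ∫⁻ a, f a ^ 2 ∂μ := by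
  have h := ENNReal.lintegral_mul_le_Lp_mul_Lq μ Real.HolderConjugate.two_two hf
    (aemeasurable_const (b := (1 : ENNReal)))
  simp only [Pi.mul_apply, mul_one, ENNReal.one_rpow, lintegral_const, one_mul] at h
  have h2 : ∀ x : ENNReal, (x ^ (1 / (2 : ℝ))) ^ 2 = x := fun x => by
    rw [← ENNReal.rpow_natCast, ← ENNReal.rpow_mul]; norm_num
  calc _ ≤ ((∫⁻ a, f a ^ (2 : ℝ) ∂μ) ^ (1 / (2 : ℝ)) * (μ univ) ^ (1 / (2 : ℝ))) ^ 2 := by gcongr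
    _ = _ := by
      rw [mul_pow, h2, h2, mul_comm]
      simp_rw [← ENNReal.rpow_natCast]
      norm_num

theorem enorm_sq_eq_lintegral {α F : Type*} [MeasurableSpace α] {μ : Measure α}
    [NormedAddCommGroup F] (f : Lp F 2 μ) : ‖f‖ₑ ^ 2 = ∫⁻ a, ‖f a‖ₑ ^ 2 ∂μ := by
  rw [Lp.enorm_def, eLpNorm_eq_lintegral_rpow_enorm_toReal (by norm_num) (by norm_num),
    ← ENNReal.rpow_natCast, ← ENNReal.rpow_mul]
  simp

theorem norm_gradient {d : ℕ} (φ : E d → ℝ) (x : E d) : ‖gradient φ x‖ = ‖fderiv ℝ φ x‖ := by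
  rw [← toDual_gradient, LinearIsometryEquiv.norm_map]

theorem continuous_gradient {d : ℕ} {φ : E d → ℝ} (hφ : ContDiff ℝ 1 φ) :
    Continuous (gradient φ) :=
  (InnerProductSpace.toDual ℝ (E d)).symm.continuous.comp (hφ.continuous_fderiv (by norm_num))

/-- The fundamental theorem of calculus along the segment, then Cauchy–Schwarz on `[0, 1]`. -/
theorem enorm_sub_sq_le_lintegral_gradient {d : ℕ} {φ : E d → ℝ} (hφ : ContDiff ℝ 1 φ)
    (x h : E d) :
    ‖φ (x + h) - φ x‖ₑ ^ 2 ≤ ‖h‖ₑ ^ 2 * ∫⁻ t in Icc (0 : ℝ) 1, ‖gradient φ (x + t • h)‖ₑ ^ 2 := by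
  have hgc := continuous_gradient hφ
  have hd : ∀ t ∈ uIcc (0 : ℝ) 1,
      HasDerivAt (fun s : ℝ => φ (x + s • h)) (fderiv ℝ φ (x + t • h) h) t := by
    intro t _
    have h1 : HasDerivAt (fun s : ℝ => x + s • h) h t := by
      simpa using ((hasDerivAt_id t).smul_const h).const_add x
    exact ((hφ.differentiable (by norm_num)) _).hasFDerivAt.comp_hasDerivAt t h1
  have hc : Continuous fun t : ℝ => fderiv ℝ φ (x + t • h) h :=
    ((hφ.continuous_fderiv (by norm_num)).comp (by fun_prop : Continuous fun t : ℝ => x + t • h)).clm_apply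
      continuous_const
  have hftc := intervalIntegral.integral_eq_sub_of_hasDerivAt hd (hc.intervalIntegrable _ _)
  simp only [one_smul, zero_smul, add_zero] at hftc
  have hm : Measurable fun t : ℝ => ‖gradient φ (x + t • h)‖ₑ :=
    (hgc.comp (by fun_prop : Continuous fun t : ℝ => x + t • h)).measurable.enorm
  have hle : ‖φ (x + h) - φ x‖ₑ ≤ ‖h‖ₑ * ∫⁻ t in Icc (0 : ℝ) 1, ‖gradient φ (x + t • h)‖ₑ := by
    rw [← hftc, intervalIntegral.integral_of_le zero_le_one, ← integral_Icc_eq_integral_Ioc,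
      ← lintegral_const_mul _ hm]
    refine (enorm_integral_le_lintegral_enorm _).trans (lintegral_mono fun t => ?_)
    have := (fderiv ℝ φ (x + t • h)).le_opNorm h
    rw [← norm_gradient, mul_comm] at this
    rw [← ofReal_norm, ← ofReal_norm, ← ofReal_norm, ← ENNReal.ofReal_mul (norm_nonneg _)]
    exact ENNReal.ofReal_le_ofReal this
  have hsq := sq_lintegral_le (μ := volume.restrict (Icc (0 : ℝ) 1)) hm.aemeasurable
  simp only [Measure.restrict_apply_univ, Real.volume_Icc, sub_zero, ENNReal.ofReal_one,
    one_mul] at hsq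
  calc _ ≤ (‖h‖ₑ * ∫⁻ t in Icc (0 : ℝ) 1, ‖gradient φ (x + t • h)‖ₑ) ^ 2 := by gcongr
    _ ≤ _ := by rw [mul_pow]; gcongr

/-- Integrate the segment estimate in `x`; by Tonelli and translation invariance each `t`
contributes the same integral. -/
theorem lintegral_enorm_sub_translate_sq_le {d : ℕ} {φ : E d → ℝ} (hφ : ContDiff ℝ 1 φ)
    (h : E d) :
    ∫⁻ x, ‖φ (x + h) - φ x‖ₑ ^ 2 ≤ ‖h‖ₑ ^ 2 * ∫⁻ x, ‖gradient φ x‖ₑ ^ 2 := by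
  have hgc := continuous_gradient hφ
  have hm : Measurable fun p : E d × ℝ => ‖gradient φ (p.1 + p.2 • h)‖ₑ ^ 2 :=
    (hgc.comp (by fun_prop : Continuous fun p : E d × ℝ => p.1 + p.2 • h)).measurable.enorm.pow_const 2
  calc ∫⁻ x, ‖φ (x + h) - φ x‖ₑ ^ 2
      ≤ ∫⁻ x, ‖h‖ₑ ^ 2 * ∫⁻ t in Icc (0 : ℝ) 1, ‖gradient φ (x + t • h)‖ₑ ^ 2 :=
        lintegral_mono fun x => enorm_sub_sq_le_lintegral_gradient hφ x h
    _ = ‖h‖ₑ ^ 2 * ∫⁻ x, ∫⁻ t in Icc (0 : ℝ) 1, ‖gradient φ (x + t • h)‖ₑ ^ 2 :=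
        lintegral_const_mul _ hm.lintegral_prod_right'
    _ = ‖h‖ₑ ^ 2 * ∫⁻ t in Icc (0 : ℝ) 1, ∫⁻ x, ‖gradient φ (x + t • h)‖ₑ ^ 2 := by
        rw [lintegral_lintegral_swap hm.aemeasurable]
    _ = ‖h‖ₑ ^ 2 * ∫⁻ x, ‖gradient φ x‖ₑ ^ 2 := by
        have : ∀ t : ℝ, ∫⁻ x, ‖gradient φ (x + t • h)‖ₑ ^ 2 = ∫⁻ x, ‖gradient φ x‖ₑ ^ 2 :=
          fun t => lintegral_add_right_eq_self (fun x => ‖gradient φ x‖ₑ ^ 2) (t • h)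
        simp_rw [this]
        simp

theorem gradient_eq_zero_of_notMem_tsupport {d : ℕ} {φ : E d → ℝ} {x : E d}
    (hx : x ∉ tsupport φ) : gradient φ x = 0 := by
  rw [← norm_eq_zero, norm_gradient, norm_eq_zero]
  by_contra h
  exact hx (support_fderiv_subset ℝ h)

variable {d : ℕ} {Ω : Opens (E d)}

/-- The gradient of a test function vanishes off `Ω`, so its norm is an integral over the whole
space, where translation is available. -/
theorem enorm_snd_sq_of_ae_eq_gradient {φ : E d → ℝ} (hs : tsupport φ ⊆ (Ω : Set (E d)))
    {g : L2Vec Ω} (hg : (g : E d → E d) =ᵐ[volume.restrict (Ω : Set (E d))] gradient φ) :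
    ‖g‖ₑ ^ 2 = ∫⁻ x, ‖gradient φ x‖ₑ ^ 2 := by
  have hsub : (Function.support fun x => ‖gradient φ x‖ₑ ^ 2) ⊆ (Ω : Set (E d)) := by
    intro x hx
    by_contra hxΩ
    exact hx (by simp [gradient_eq_zero_of_notMem_tsupport fun h => hxΩ (hs h)])
  rw [enorm_sq_eq_lintegral, ← setLIntegral_eq_of_support_subset hsub]
  refine lintegral_congr_ae ?_
  filter_upwards [hg] with x hx
  rw [hx]

theorem exists_forall_mem_H10_norm_fst_le (hd : 1 ≤ d)
    (hΩ : Bornology.IsBounded (Ω : Set (E d))) :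
    ∃ C : ℝ, 0 < C ∧ ∀ p ∈ H10 Ω, ‖p.1‖ ≤ C * ‖p.2‖ := by
  obtain ⟨R, hR0, hR⟩ := hΩ.subset_ball_lt 0 0
  -- A shift of length `2 R` carries `Ω`, which lies in the open ball of radius `R`, off itself, so
  -- `φ (x + h) - φ x = -φ x` on `Ω`.
  let h : E d := EuclideanSpace.single ⟨0, hd⟩ (2 * R)
  have hh : ‖h‖ = 2 * R := by simp [h, abs_of_pos hR0]
  refine ⟨2 * R, by positivity, fun p hp => ?_⟩
  have hclosed : IsClosed {p : L2 Ω × L2Vec Ω | ‖p.1‖ ≤ 2 * R * ‖p.2‖} :=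
    isClosed_le (by fun_prop) (by fun_prop)
  refine closure_minimal ?_ hclosed hp
  rintro ⟨f, g⟩ ⟨φ, hφ, -, hs, hf, hg⟩
  have hout : ∀ x ∈ (Ω : Set (E d)), φ (x + h) = 0 := by
    intro x hx
    refine image_eq_zero_of_notMem_tsupport fun hx' => ?_
    have h1 := mem_ball_zero_iff.1 (hR hx)
    have h2 := mem_ball_zero_iff.1 (hR (hs hx'))
    have h3 : ‖h‖ ≤ ‖x + h‖ + ‖x‖ := by
      simpa using norm_sub_le (x + h) x
    linarith
  have hkey : ‖f‖ₑ ^ 2 ≤ ‖h‖ₑ ^ 2 * ‖g‖ₑ ^ 2 := by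
    rw [enorm_snd_sq_of_ae_eq_gradient hs hg]
    refine le_trans ?_ (lintegral_enorm_sub_translate_sq_le
      (hφ.of_le (by exact_mod_cast le_top)) h)
    rw [enorm_sq_eq_lintegral]
    refine le_trans (le_of_eq ?_) (setLIntegral_le_lintegral (Ω : Set (E d)) _)
    refine lintegral_congr_ae ?_
    filter_upwards [hf, ae_restrict_mem Ω.isOpen.measurableSet] with x hx hxΩ
    rw [hx, hout x hxΩ, zero_sub, enorm_neg]
  rw [← mul_pow, ENNReal.pow_le_pow_left_iff two_ne_zero, ← ofReal_norm, ← ofReal_norm,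
    ← ofReal_norm, ← ENNReal.ofReal_mul (norm_nonneg _),
    ENNReal.ofReal_le_ofReal_iff (by positivity), hh] at hkey
  exact hkey

end Translations

/-! ### Rellich compactness by averaging over cubes -/

section CellAverages

section Cells

variable {d : ℕ}

/-- The index of the cell of the cubic grid of mesh `ε` which contains `x`. -/
noncomputable def cellIndex (ε : ℝ) (x : E d) : Fin d → ℤ := fun i => ⌊x i / ε⌋

/-- The cells of the cubic grid of mesh `ε`. -/
def cell (ε : ℝ) (k : Fin d → ℤ) : Set (E d) := {x | cellIndex ε x = k}

theorem cell_eq_preimage {ε : ℝ} (hε : 0 < ε) (k : Fin d → ℤ) :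
    cell ε k = (WithLp.ofLp : E d → Fin d → ℝ) ⁻¹'
      univ.pi fun i => Ico (k i * ε) ((k i + 1) * ε) := by
  ext x
  simp only [cell, cellIndex, mem_ofPred_eq, funext_iff, mem_preimage, mem_univ_pi, mem_Ico,
    Int.floor_eq_iff, le_div_iff₀ hε, div_lt_iff₀ hε]

theorem measurableSet_cell {ε : ℝ} (hε : 0 < ε) (k : Fin d → ℤ) : MeasurableSet (cell ε k) := by
  rw [cell_eq_preimage hε]
  exact (PiLp.volume_preserving_ofLp (Fin d)).measurable
    (MeasurableSet.univ_pi fun i => measurableSet_Ico)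

theorem volume_cell {ε : ℝ} (hε : 0 < ε) (k : Fin d → ℤ) :
    volume (cell ε k) = ENNReal.ofReal (ε ^ d) := by
  rw [cell_eq_preimage hε, (PiLp.volume_preserving_ofLp (Fin d)).measure_preimage
    (MeasurableSet.univ_pi fun i => measurableSet_Ico).nullMeasurableSet, Real.volume_pi_Ico]
  have : ∀ i, ((k i : ℝ) + 1) * ε - k i * ε = ε := fun i => by ring
  simp [this, ENNReal.ofReal_pow hε.le]

theorem norm_sub_le_of_mem_cell {ε : ℝ} (hε : 0 < ε) {k : Fin d → ℤ} {x y : E d}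
    (hx : x ∈ cell ε k) (hy : y ∈ cell ε k) : ‖y - x‖ ≤ √d * ε := by
  rw [cell_eq_preimage hε] at hx hy
  have hi : ∀ i, ‖(y - x) i‖ ^ 2 ≤ ε ^ 2 := fun i => by
    have h1 := hx i (mem_univ i)
    have h2 := hy i (mem_univ i)
    simp only [mem_Ico] at h1 h2
    rw [Real.norm_eq_abs, sq_abs, PiLp.sub_apply]
    exact sq_le_sq' (by linarith) (by linarith)
  rw [EuclideanSpace.norm_eq]
  refine (Real.sqrt_le_sqrt (Finset.sum_le_sum fun i _ => hi i)).trans_eq ?_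
  simp [Real.sqrt_sq hε.le]

theorem finite_image_cellIndex {ε : ℝ} {s : Set (E d)} (hs : Bornology.IsBounded s) :
    (cellIndex ε '' s).Finite := by
  obtain ⟨R, hR⟩ := hs.subset_closedBall 0
  refine (Set.finite_Icc (fun _ : Fin d => ⌊-(R * |ε⁻¹|)⌋) (fun _ => ⌊R * |ε⁻¹|⌋)).subset ?_
  rintro _ ⟨x, hx, rfl⟩
  have h1 : ∀ i, |x i / ε| ≤ R * |ε⁻¹| := fun i => by
    rw [div_eq_mul_inv, abs_mul]
    gcongr
    exact (PiLp.norm_apply_le x i).trans (mem_closedBall_zero_iff.1 (hR hx))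
  exact ⟨fun i => Int.floor_mono (abs_le.1 (h1 i)).1, fun i => Int.floor_mono (abs_le.1 (h1 i)).2⟩

/-- Cauchy–Schwarz for the mean over the cell. Enlarging the cell to a ball about `x` makes the
range of `h` independent of `x`, ready for Tonelli. -/
theorem enorm_sub_average_sq_le {φ : E d → ℝ} (hφ : Continuous φ) {ε : ℝ} (hε : 0 < ε)
    (x : E d) :
    ‖φ x - ⨍ y in cell ε (cellIndex ε x), φ y‖ₑ ^ 2 ≤ (ENNReal.ofReal (ε ^ d))⁻¹ *
      ∫⁻ h in Metric.closedBall (0 : E d) (√d * ε), ‖φ (x + h) - φ x‖ₑ ^ 2 := by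
  set Q := cell ε (cellIndex ε x) with hQ
  set v := ENNReal.ofReal (ε ^ d) with hv
  have hv0 : v ≠ 0 := by simp [hv, hε]
  have hvt : v ≠ ⊤ := ENNReal.ofReal_ne_top
  have hvol : volume Q = v := volume_cell hε _
  have hxQ : x ∈ Q := rfl
  have hsubset : Q ⊆ Metric.closedBall x (√d * ε) := fun y hy => by
    rw [mem_closedBall_iff_norm]
    exact norm_sub_le_of_mem_cell hε hxQ hy
  have hint : IntegrableOn φ Q volume :=
    (hφ.continuousOn.integrableOn_compact (isCompact_closedBall x (√d * ε))).mono_set hsubset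
  have hconst : IntegrableOn (fun _ => φ x) Q volume := integrableOn_const (by rw [hvol]; exact hvt)
  have havg : φ x - ⨍ y in Q, φ y = ⨍ y in Q, (φ x - φ y) := by
    rw [setAverage_eq, setAverage_eq, integral_sub hconst hint,
      smul_sub, setIntegral_const, smul_smul, inv_mul_cancel₀, one_smul]
    simp [Measure.real, hvol, ENNReal.toReal_eq_zero_iff, hv0, hvt]
  have hm : Measurable fun y => ‖φ x - φ y‖ₑ := (continuous_const.sub hφ).measurable.enorm
  have h1 : ‖⨍ y in Q, (φ x - φ y)‖ₑ ≤ v⁻¹ * ∫⁻ y in Q, ‖φ x - φ y‖ₑ := by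
    rw [setAverage_eq, enorm_smul]
    refine mul_le_mul' (le_of_eq ?_) (enorm_integral_le_lintegral_enorm _)
    rw [Measure.real, hvol, ← ENNReal.toReal_inv, Real.enorm_of_nonneg ENNReal.toReal_nonneg,
      ENNReal.ofReal_toReal (by simp [hv0])]
  have h2 := sq_lintegral_le (μ := volume.restrict Q) hm.aemeasurable
  rw [Measure.restrict_apply_univ, hvol] at h2
  have h3 : ∫⁻ y in Q, ‖φ x - φ y‖ₑ ^ 2
      ≤ ∫⁻ h in Metric.closedBall (0 : E d) (√d * ε), ‖φ (x + h) - φ x‖ₑ ^ 2 := by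
    calc ∫⁻ y in Q, ‖φ x - φ y‖ₑ ^ 2
        ≤ ∫⁻ y in Metric.closedBall x (√d * ε), ‖φ x - φ y‖ₑ ^ 2 := lintegral_mono_set hsubset
      _ = ∫⁻ y, (Metric.closedBall x (√d * ε)).indicator (fun y => ‖φ x - φ y‖ₑ ^ 2) y :=
          (lintegral_indicator Metric.isClosed_closedBall.measurableSet _).symm
      _ = ∫⁻ h, (Metric.closedBall x (√d * ε)).indicator (fun y => ‖φ x - φ y‖ₑ ^ 2) (x + h) :=
          (lintegral_add_left_eq_self _ x).symm
      _ = ∫⁻ h, (Metric.closedBall (0 : E d) (√d * ε)).indicator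
            (fun h => ‖φ (x + h) - φ x‖ₑ ^ 2) h := by
          refine lintegral_congr fun h => ?_
          simp only [indicator, mem_closedBall_iff_norm, add_sub_cancel_left, sub_zero]
          rw [← enorm_neg (φ x - φ (x + h)), neg_sub]
      _ = _ := lintegral_indicator Metric.isClosed_closedBall.measurableSet _
  calc ‖φ x - ⨍ y in Q, φ y‖ₑ ^ 2 ≤ (v⁻¹ * ∫⁻ y in Q, ‖φ x - φ y‖ₑ) ^ 2 := by
        rw [havg]; gcongr
    _ = v⁻¹ * v⁻¹ * (∫⁻ y in Q, ‖φ x - φ y‖ₑ) ^ 2 := by ring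
    _ ≤ v⁻¹ * v⁻¹ * (v * ∫⁻ y in Q, ‖φ x - φ y‖ₑ ^ 2) := by gcongr
    _ = v⁻¹ * (v⁻¹ * v) * ∫⁻ y in Q, ‖φ x - φ y‖ₑ ^ 2 := by ring
    _ = v⁻¹ * ∫⁻ y in Q, ‖φ x - φ y‖ₑ ^ 2 := by rw [ENNReal.inv_mul_cancel hv0 hvt, mul_one]
    _ ≤ _ := by gcongr

theorem lintegral_enorm_sub_average_sq_le {φ : E d → ℝ} (hφ : ContDiff ℝ 1 φ) {ε : ℝ}
    (hε : 0 < ε) :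
    ∫⁻ x, ‖φ x - ⨍ y in cell ε (cellIndex ε x), φ y‖ₑ ^ 2 ≤
      ENNReal.ofReal (√d ^ d) * volume (Metric.ball (0 : E d) 1) * ENNReal.ofReal (√d * ε) ^ 2 *
        ∫⁻ x, ‖gradient φ x‖ₑ ^ 2 := by
  set v := ENNReal.ofReal (ε ^ d) with hv
  have hv0 : v ≠ 0 := by simp [hv, hε]
  have hvt : v ≠ ⊤ := ENNReal.ofReal_ne_top
  set B := Metric.closedBall (0 : E d) (√d * ε) with hB
  set D := ∫⁻ x, ‖gradient φ x‖ₑ ^ 2 with hD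
  have hm : Measurable fun p : E d × E d => ‖φ (p.1 + p.2) - φ p.1‖ₑ ^ 2 := by
    have hc := hφ.continuous
    exact (by fun_prop : Continuous fun p : E d × E d => φ (p.1 + p.2) - φ p.1).measurable.enorm.pow_const 2
  -- The ratio of the volumes of ball and cell does not depend on `ε`, so the final factor is of
  -- order `ε ^ 2`.
  have hvolB : volume B = v * (ENNReal.ofReal (√d ^ d) * volume (Metric.ball (0 : E d) 1)) := by
    rw [hB, Measure.addHaar_closedBall _ _ (by positivity), finrank_euclideanSpace_fin, mul_pow,
      ENNReal.ofReal_mul (by positivity)]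
    ring
  calc ∫⁻ x, ‖φ x - ⨍ y in cell ε (cellIndex ε x), φ y‖ₑ ^ 2
      ≤ ∫⁻ x, v⁻¹ * ∫⁻ h in B, ‖φ (x + h) - φ x‖ₑ ^ 2 :=
        lintegral_mono fun x => enorm_sub_average_sq_le hφ.continuous hε x
    _ = v⁻¹ * ∫⁻ h in B, ∫⁻ x, ‖φ (x + h) - φ x‖ₑ ^ 2 := by
        rw [lintegral_const_mul _ hm.lintegral_prod_right', lintegral_lintegral_swap hm.aemeasurable]
    _ ≤ v⁻¹ * ∫⁻ h in B, ENNReal.ofReal (√d * ε) ^ 2 * D := by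
        refine mul_le_mul_right (setLIntegral_mono measurable_const fun h hh => ?_) _
        refine (lintegral_enorm_sub_translate_sq_le hφ h).trans ?_
        have : ‖h‖ₑ ≤ ENNReal.ofReal (√d * ε) := by
          rw [← ofReal_norm]
          exact ENNReal.ofReal_le_ofReal (mem_closedBall_zero_iff.1 hh)
        gcongr
    _ = v⁻¹ * v * (ENNReal.ofReal (√d ^ d) * volume (Metric.ball (0 : E d) 1)) *
          ENNReal.ofReal (√d * ε) ^ 2 * D := by
        rw [setLIntegral_const, hvolB]; ring
    _ = _ := by rw [ENNReal.inv_mul_cancel hv0 hvt, one_mul]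

end Cells

variable {d : ℕ} {Ω : Opens (E d)}

theorem exists_finiteDimensional_approximation (hΩ : Bornology.IsBounded (Ω : Set (E d)))
    {δ : ℝ} (hδ : 0 < δ) :
    ∃ W : Submodule ℝ (L2 Ω), FiniteDimensional ℝ W ∧
      ∀ p ∈ H10 Ω, ∃ w ∈ W, ‖p.1 - w‖ ≤ δ * ‖p.2‖ := by
  set C : ℝ := (ENNReal.ofReal (√d ^ d) * volume (Metric.ball (0 : E d) 1)).toReal * √d ^ 2 with hC
  have hC0 : 0 ≤ C := by positivity
  obtain ⟨ε, hε, hεδ⟩ : ∃ ε : ℝ, 0 < ε ∧ C * ε ^ 2 ≤ δ ^ 2 := by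
    -- `C + 1` avoids division by a possibly vanishing `C`.
    refine ⟨δ / √(C + 1), by positivity, ?_⟩
    rw [div_pow, Real.sq_sqrt (by positivity), mul_div_assoc', div_le_iff₀ (by positivity)]
    nlinarith [sq_nonneg δ]
  have hconst : ENNReal.ofReal (√d ^ d) * volume (Metric.ball (0 : E d) 1) *
      ENNReal.ofReal (√d * ε) ^ 2 ≤ ENNReal.ofReal δ ^ 2 := by
    have hfin : ENNReal.ofReal (√d ^ d) * volume (Metric.ball (0 : E d) 1) ≠ ⊤ :=
      ENNReal.mul_ne_top ENNReal.ofReal_ne_top measure_ball_lt_top.ne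
    rw [← ENNReal.ofReal_toReal hfin, ← ENNReal.ofReal_pow (by positivity),
      ← ENNReal.ofReal_pow hδ.le, ← ENNReal.ofReal_mul ENNReal.toReal_nonneg]
    refine ENNReal.ofReal_le_ofReal (le_trans (le_of_eq ?_) hεδ)
    rw [hC]; ring
  set S : Finset (Fin d → ℤ) := (finite_image_cellIndex (ε := ε) hΩ).toFinset with hS
  have hfinite : ∀ k : Fin d → ℤ, (volume.restrict (Ω : Set (E d))) (cell ε k) ≠ ⊤ := fun k =>
    ((Measure.restrict_apply_le _ _).trans_lt
      (by rw [volume_cell hε]; exact ENNReal.ofReal_lt_top)).ne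
  let ind : (Fin d → ℤ) → L2 Ω := fun k =>
    indicatorConstLp 2 (measurableSet_cell hε k) (hfinite k) (1 : ℝ)
  let W : Submodule ℝ (L2 Ω) := Submodule.span ℝ (ind '' S)
  have hW : FiniteDimensional ℝ W := FiniteDimensional.span_of_finite ℝ (S.finite_toSet.image ind)
  -- Stated for the projection, which is continuous, rather than for the cell averages, so that the
  -- inequality passes to the closure `H10 Ω`.
  have happ : ∀ p ∈ testPairs Ω, ‖p.1 - W.starProjection p.1‖ ≤ δ * ‖p.2‖ := by
    rintro ⟨f, g⟩ ⟨φ, hφ, -, hs, hf, hg⟩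
    set w : L2 Ω := ∑ k ∈ S, (⨍ y in cell ε k, φ y) • ind k with hw
    have hwW : w ∈ W := Submodule.sum_mem _ fun k hk =>
      Submodule.smul_mem _ _ (Submodule.subset_span ⟨k, hk, rfl⟩)
    have hwx : ∀ᵐ x ∂volume.restrict (Ω : Set (E d)),
        w x = ⨍ y in cell ε (cellIndex ε x), φ y := by
      have h1 : ∀ᵐ x ∂volume.restrict (Ω : Set (E d)), ∀ k ∈ S,
          ((⨍ y in cell ε k, φ y) • ind k : L2 Ω) x
            = (⨍ y in cell ε k, φ y) * (cell ε k).indicator (fun _ => (1 : ℝ)) x := by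
        rw [Filter.eventually_all_finset]
        intro k _
        filter_upwards [Lp.coeFn_smul (⨍ y in cell ε k, φ y) (ind k),
          indicatorConstLp_coeFn (p := 2) (hs := measurableSet_cell hε k) (hμs := hfinite k)
            (c := (1 : ℝ))] with x hx1 hx2
        rw [hx1, Pi.smul_apply, smul_eq_mul, hx2]
      filter_upwards [h1, Lp.coeFn_finsetSum S fun k => ((⨍ y in cell ε k, φ y) • ind k : L2 Ω),
        ae_restrict_mem Ω.isOpen.measurableSet] with x hx1 hx2 hxΩ
      rw [hw, hx2, Finset.sum_apply, Finset.sum_congr rfl hx1,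
        Finset.sum_eq_single (cellIndex ε x)]
      · simp [cell]
      · intro k _ hk
        simp [cell, hk.symm]
      · intro hx
        exact absurd ((finite_image_cellIndex (ε := ε) hΩ).mem_toFinset.2 ⟨x, hxΩ, rfl⟩) hx
    have hkey : ‖f - w‖ₑ ^ 2 ≤ ENNReal.ofReal δ ^ 2 * ‖g‖ₑ ^ 2 := by
      rw [enorm_snd_sq_of_ae_eq_gradient hs hg, enorm_sq_eq_lintegral]
      calc ∫⁻ x in (Ω : Set (E d)), ‖(f - w : L2 Ω) x‖ₑ ^ 2
          = ∫⁻ x in (Ω : Set (E d)), ‖φ x - ⨍ y in cell ε (cellIndex ε x), φ y‖ₑ ^ 2 := by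
            refine lintegral_congr_ae ?_
            filter_upwards [hf, hwx, Lp.coeFn_sub f w] with x h1 h2 h3
            rw [h3, Pi.sub_apply, h1, h2]
        _ ≤ ∫⁻ x, ‖φ x - ⨍ y in cell ε (cellIndex ε x), φ y‖ₑ ^ 2 := setLIntegral_le_lintegral _ _
        _ ≤ _ := lintegral_enorm_sub_average_sq_le (hφ.of_le (by exact_mod_cast le_top)) hε
        _ ≤ _ := by gcongr
    rw [← mul_pow, ENNReal.pow_le_pow_left_iff two_ne_zero, ← ofReal_norm, ← ofReal_norm,
      ← ENNReal.ofReal_mul hδ.le, ENNReal.ofReal_le_ofReal_iff (by positivity)] at hkey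
    refine le_trans ?_ hkey
    rw [Submodule.starProjection_minimal]
    refine ciInf_le ⟨0, ?_⟩ (⟨w, hwW⟩ : W)
    rintro _ ⟨_, rfl⟩
    exact norm_nonneg _
  refine ⟨W, hW, fun p hp => ⟨W.starProjection p.1, W.starProjection_apply_mem _, ?_⟩⟩
  have hclosed : IsClosed {p : L2 Ω × L2Vec Ω | ‖p.1 - W.starProjection p.1‖ ≤ δ * ‖p.2‖} :=
    isClosed_le (by fun_prop) (by fun_prop)
  exact closure_minimal happ hclosed hp

end CellAverages

/-! ### Superposition and concatenation of weak solutions -/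

section Concatenation

variable {H K ι : Type*} [NormedAddCommGroup H] [InnerProductSpace ℝ H]
  [NormedAddCommGroup K] [InnerProductSpace ℝ K]

theorem intervalIntegrable_inner_of_memLp {G : ℝ → K}
    (hG : ∀ T : ℝ, 0 < T → MemLp G 2 (volume.restrict (Ioo 0 T))) (k : K) {a b : ℝ}
    (ha : 0 ≤ a) (hab : a ≤ b) : IntervalIntegrable (fun s => inner ℝ (G s) k) volume a b := by
  rw [intervalIntegrable_iff_integrableOn_Ioc_of_le hab]
  have h1 : IntegrableOn G (Ioo 0 (b + 1)) :=
    (hG (b + 1) (by linarith)).integrable (by norm_num)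
  exact (h1.mono_set fun s hs => ⟨ha.trans_lt hs.1, by linarith [hs.2]⟩).inner_const k

theorem IsWeakSolution.congr_ae {V : Set (H × K)} {y₀ : H} {F F' y : ℝ → H}
    (h : IsWeakSolution V y₀ F y) (hF : ∀ᵐ s ∂volume.restrict (Ioi (0 : ℝ)), F' s = F s) :
    IsWeakSolution V y₀ F' y := by
  obtain ⟨hc, h0, G, hG, hV, hw⟩ := h
  refine ⟨hc, h0, G, hG, hV, fun q hq t ht => ?_⟩
  rw [hw q hq t ht, intervalIntegral.integral_of_le ht, intervalIntegral.integral_of_le ht]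
  congr 1
  refine integral_congr_ae ?_
  filter_upwards [ae_restrict_of_ae_restrict_of_subset Ioc_subset_Ioi_self hF] with s hs
  rw [hs]

theorem IsWeakSolution.add_homogeneous {V : Submodule ℝ (H × K)} {y₀ z₀ : H} {F y z : ℝ → H}
    (hy : IsWeakSolution (V : Set (H × K)) y₀ F y)
    (hz : IsWeakSolution (V : Set (H × K)) z₀ (fun _ => 0) z) :
    IsWeakSolution (V : Set (H × K)) (y₀ + z₀) F (fun t => y t + z t) := by
  obtain ⟨hc, h0, G, hG, hV, hw⟩ := hy
  obtain ⟨hc', h0', G', hG', hV', hw'⟩ := hz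
  refine ⟨hc.add hc', by simp [h0, h0'], fun t => G t + G' t,
    fun T hT => (hG T hT).add (hG' T hT), ?_, fun q hq t ht => ?_⟩
  · filter_upwards [hV, hV'] with t h1 h2
    exact V.add_mem h1 h2
  · have h1 := hw q hq t ht
    have h2 := hw' q hq t ht
    simp only [inner_zero_left, intervalIntegral.integral_zero, add_zero] at h2
    simp only [inner_add_left]
    rw [intervalIntegral.integral_add (intervalIntegrable_inner_of_memLp hG _ le_rfl ht)
      (intervalIntegrable_inner_of_memLp hG' _ le_rfl ht)]
    linarith

/-- Following a weak solution up to time `t` and a homogeneous one from then on gives a weak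
solution. -/
theorem IsWeakSolution.concat {V : Set (H × K)} {y₀ : H} {F F' y z : ℝ → H} {t : ℝ}
    (ht : 0 < t) (hy : IsWeakSolution V y₀ F y) (hz : IsWeakSolution V (y t) (fun _ => 0) z)
    (hF : ∀ᵐ s ∂volume.restrict (Ioc 0 t), F' s = F s) (hFi : IntegrableOn F (Ioc 0 t))
    (hF0 : ∀ᵐ s ∂volume.restrict (Ioi t), F' s = 0) :
    IsWeakSolution V y₀ F' (fun s => if s ≤ t then y s else z (s - t)) := by
  classical
  obtain ⟨hc, h0, G, hG, hV, hw⟩ := hy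
  obtain ⟨hc', h0', G', hG', hV', hw'⟩ := hz
  set L : ℝ → K := (Iic t).piecewise G fun s => G' (s - t) with hL
  have hL1 : ∀ s, s ≤ t → L s = G s := fun s hs => piecewise_eq_of_mem _ _ _ hs
  have hL2 : ∀ s, t < s → L s = G' (s - t) := fun s hs =>
    piecewise_eq_of_notMem _ _ _ (not_le.2 hs)
  have hLm : ∀ T : ℝ, 0 < T → MemLp L 2 (volume.restrict (Ioo 0 T)) := by
    intro T hT
    refine MemLp.piecewise measurableSet_Iic ((hG T hT).restrict _) ?_
    have hp : MeasurePreserving (fun s : ℝ => s - t) (volume.restrict (Ioo t (T + t)))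
        (volume.restrict (Ioo 0 T)) := by
      have := (measurePreserving_sub_right (volume : Measure ℝ) t).restrict_preimage
        (measurableSet_Ioo (a := 0) (b := T))
      simpa using this
    refine ((hG' T hT).comp_measurePreserving hp).mono_measure ?_
    rw [Measure.restrict_restrict measurableSet_Iic.compl]
    have hsub : (Iic t)ᶜ ∩ Ioo 0 T ⊆ Ioo t (T + t) := fun s hs =>
      ⟨not_le.1 hs.1, by linarith [hs.2.2]⟩
    exact Measure.restrict_mono hsub le_rfl
  refine ⟨?_, by simp [ht.le, h0], L, hLm, ?_, fun q hq τ hτ => ?_⟩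
  · intro s hs
    have hA : ContinuousOn (fun s => if s ≤ t then y s else z (s - t)) (Icc 0 t) :=
      (hc.mono Icc_subset_Ici_self).congr fun s hs => if_pos hs.2
    -- At `s = t` the two branches agree because `z 0 = y t`.
    have hB : ContinuousOn (fun s => if s ≤ t then y s else z (s - t)) (Ici t) := by
      have : ContinuousOn (fun s => z (s - t)) (Ici t) :=
        hc'.comp (by fun_prop) fun s hs => by simpa using hs
      refine this.congr fun s hs => ?_
      by_cases h : s ≤ t
      · have : s = t := le_antisymm h hs
        simp [this, h0']
      · simp [h]
    have := hA.union_of_isClosed hB isClosed_Icc isClosed_Ici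
    rw [Icc_union_Ici_eq_Ici ht.le] at this
    exact this s hs
  · rw [← Ioc_union_Ioi_eq_Ioi ht.le, ae_restrict_union_iff]
    constructor
    · filter_upwards [ae_restrict_of_ae_restrict_of_subset Ioc_subset_Ioi_self hV,
        ae_restrict_mem measurableSet_Ioc] with s h1 h2
      rw [if_pos h2.2, hL1 s h2.2]
      exact h1
    · have hp : MeasurePreserving (fun s : ℝ => s - t) (volume.restrict (Ioi t))
          (volume.restrict (Ioi 0)) := by
        have := (measurePreserving_sub_right (volume : Measure ℝ) t).restrict_preimage
          (measurableSet_Ioi (a := 0))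
        simpa using this
      filter_upwards [hp.quasiMeasurePreserving.ae hV', ae_restrict_mem measurableSet_Ioi] with s h1 h2
      rw [if_neg (not_le.2 h2), hL2 s h2]
      exact h1
  · have hLint : ∀ a b, 0 ≤ a → a ≤ b → b ≤ t →
        ∫ s in a..b, inner ℝ (L s) q.2 = ∫ s in a..b, inner ℝ (G s) q.2 := by
      intro a b ha hab hb
      refine intervalIntegral.integral_congr fun s hs => ?_
      rw [uIcc_of_le hab] at hs
      simp only [hL1 s (hs.2.trans hb)]
    have hFint : ∀ b, 0 ≤ b → b ≤ t →
        ∫ s in 0..b, inner ℝ (F' s) q.1 = ∫ s in 0..b, inner ℝ (F s) q.1 := by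
      intro b hb hbt
      rw [intervalIntegral.integral_of_le hb, intervalIntegral.integral_of_le hb]
      refine integral_congr_ae ?_
      filter_upwards [ae_restrict_of_ae_restrict_of_subset (Ioc_subset_Ioc_right hbt) hF] with s hs
      rw [hs]
    rcases le_or_gt τ t with hle | hlt
    · beta_reduce
      rw [if_pos hle, hLint 0 τ le_rfl hτ hle, hFint τ hτ hle]
      exact hw q hq τ hτ
    -- Past `t`, add the identity for `y` at `t` to that for `z` at `τ - t`: the pairing with `y t`
    -- cancels.
    · have h1 := hw q hq t ht.le
      have h2 := hw' q hq (τ - t) (by linarith)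
      simp only [inner_zero_left, intervalIntegral.integral_zero, add_zero] at h2
      have h3 : ∫ s in t..τ, inner ℝ (L s) q.2 = ∫ s in 0..(τ - t), inner ℝ (G' s) q.2 := by
        rw [show (∫ s in 0..(τ - t), inner ℝ (G' s) q.2)
          = ∫ s in (t - t)..(τ - t), inner ℝ (G' s) q.2 by rw [sub_self],
          ← intervalIntegral.integral_comp_sub_right (fun s => inner ℝ (G' s) q.2),
          intervalIntegral.integral_of_le hlt.le, intervalIntegral.integral_of_le hlt.le]
        exact setIntegral_congr_fun measurableSet_Ioc fun s hs => by simp only [hL2 s hs.1]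
      have hz0 : (fun s => inner ℝ (F' s) q.1) =ᵐ[volume.restrict (Ioc t τ)] fun _ => 0 := by
        filter_upwards [ae_restrict_of_ae_restrict_of_subset Ioc_subset_Ioi_self hF0] with s hs
        rw [hs, inner_zero_left]
      have h4 : ∫ s in t..τ, inner ℝ (F' s) q.1 = 0 := by
        rw [intervalIntegral.integral_of_le hlt.le]
        exact integral_eq_zero_of_ae hz0
      have hi1 : IntervalIntegrable (fun s => inner ℝ (F' s) q.1) volume 0 t := by
        rw [intervalIntegrable_iff_integrableOn_Ioc_of_le ht.le]
        refine (hFi.inner_const q.1).congr ?_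
        filter_upwards [hF] with s hs
        rw [hs]
      have hi2 : IntervalIntegrable (fun s => inner ℝ (F' s) q.1) volume t τ := by
        rw [intervalIntegrable_iff_integrableOn_Ioc_of_le hlt.le]
        exact (integrable_zero _ _ _).congr hz0.symm
      beta_reduce
      rw [if_neg (not_le.2 hlt), ← intervalIntegral.integral_add_adjacent_intervals
        (intervalIntegrable_inner_of_memLp hLm q.2 le_rfl ht.le)
        (intervalIntegrable_inner_of_memLp hLm q.2 ht.le hlt.le),
        ← intervalIntegral.integral_add_adjacent_intervals hi1 hi2,
        hLint 0 t le_rfl ht.le le_rfl, hFint t ht.le le_rfl, h3, h4]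
      linarith

theorem Eigenbasis.norm_freeState_antitone [CompleteSpace H] {V : Submodule ℝ (H × K)}
    (e : Eigenbasis V ι) (y : H) {s t : ℝ} (hs : 0 ≤ s) (hst : s ≤ t) :
    ‖e.freeState y t‖ ≤ ‖e.freeState y s‖ := by
  refine le_of_sq_le_sq ?_ (norm_nonneg _)
  have ht := hs.trans hst
  rw [freeState, freeState,
    norm_sq_tsum_smul_of_orthogonal e.inner_basis_of_ne (e.summable_coeff_basis y ht),
    norm_sq_tsum_smul_of_orthogonal e.inner_basis_of_ne (e.summable_coeff_basis y hs)]
  refine (e.summable_coeff_basis y ht).tsum_le_tsum (fun i => ?_) (e.summable_coeff_basis y hs)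
  refine mul_le_mul_of_nonneg_right (sq_le_sq.2 ?_) (by positivity)
  simp only [coeff, abs_mul, Real.abs_exp]
  have := e.eigenvalue_nonneg i
  gcongr

end Concatenation

/-! ### The Dirichlet Laplacian and its first eigenvalue -/

section DirichletLaplacian

variable {d : ℕ} {Ω : Opens (E d)}

theorem gradient_add_smul {φ ψ : E d → ℝ} (hφ : Differentiable ℝ φ) (hψ : Differentiable ℝ ψ)
    (c : ℝ) (x : E d) :
    gradient (fun z => φ z + c * ψ z) x = gradient φ x + c • gradient ψ x := by
  have h : HasFDerivAt (fun z => φ z + c * ψ z) (fderiv ℝ φ x + c • fderiv ℝ ψ x) x :=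
    (hφ x).hasFDerivAt.add ((hψ x).hasFDerivAt.const_mul c)
  simp [gradient, h.fderiv]

theorem add_smul_mem_testPairs {p q : L2 Ω × L2Vec Ω} (hp : p ∈ testPairs Ω) (hq : q ∈ testPairs Ω)
    (c : ℝ) : p + c • q ∈ testPairs Ω := by
  obtain ⟨φ, hφ, hφc, hφs, hφ1, hφ2⟩ := hp
  obtain ⟨ψ, hψ, hψc, hψs, hψ1, hψ2⟩ := hq
  have hsub : tsupport (fun z => c * ψ z) ⊆ tsupport ψ := tsupport_smul_subset_right (fun _ => c) ψ
  refine ⟨fun z => φ z + c * ψ z, hφ.add (contDiff_const.mul hψ), hφc.add (hψc.mul_left),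
    (tsupport_add φ _).trans (union_subset hφs (hsub.trans hψs)), ?_, ?_⟩
  · filter_upwards [hφ1, hψ1, Lp.coeFn_add p.1 (c • q.1), Lp.coeFn_smul c q.1] with x h1 h2 h3 h4
    rw [Prod.fst_add, Prod.smul_fst, h3, Pi.add_apply, h4, Pi.smul_apply, h1, h2, smul_eq_mul]
  · filter_upwards [hφ2, hψ2, Lp.coeFn_add p.2 (c • q.2), Lp.coeFn_smul c q.2] with x h1 h2 h3 h4
    rw [Prod.snd_add, Prod.smul_snd, h3, Pi.add_apply, h4, Pi.smul_apply, h1, h2,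
      gradient_add_smul (hφ.differentiable (by simp)) (hψ.differentiable (by simp))]

theorem zero_mem_testPairs : (0 : L2 Ω × L2Vec Ω) ∈ testPairs Ω := by
  refine ⟨fun _ => 0, contDiff_const, HasCompactSupport.zero, by simp [tsupport], ?_, ?_⟩
  · filter_upwards [Lp.coeFn_zero ℝ 2 (volume.restrict (Ω : Set (E d)))] with x h
    simpa using h
  · filter_upwards [Lp.coeFn_zero (E d) 2 (volume.restrict (Ω : Set (E d)))] with x h
    have : gradient (fun _ : E d => (0 : ℝ)) x = 0 := by simp [gradient]
    rw [this]
    simpa using h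

/-- The Sobolev space `H¹₀(Ω)` as a subspace. -/
noncomputable def sobolevSubmodule (Ω : Opens (E d)) : Submodule ℝ (L2 Ω × L2Vec Ω) :=
  Submodule.topologicalClosure
    { carrier := testPairs Ω
      add_mem' := fun {p q} hp hq => by simpa using add_smul_mem_testPairs hp hq 1
      zero_mem' := zero_mem_testPairs
      smul_mem' := fun c p hp => by simpa using add_smul_mem_testPairs zero_mem_testPairs hp c }

theorem coe_sobolevSubmodule : (sobolevSubmodule Ω : Set (L2 Ω × L2Vec Ω)) = H10 Ω :=
  Submodule.topologicalClosure_coe _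

/-- The fundamental lemma of the calculus of variations; boundedness of `Ω` makes `f` integrable. -/
theorem eq_zero_of_forall_inner_H10_eq_zero (hΩ : Bornology.IsBounded (Ω : Set (E d))) (f : L2 Ω)
    (hf : ∀ p ∈ H10 Ω, inner ℝ f p.1 = 0) : f = 0 := by
  have hfin : IsFiniteMeasure (volume.restrict (Ω : Set (E d))) :=
    ⟨by simpa using hΩ.measure_lt_top⟩
  have hint : IntegrableOn f (Ω : Set (E d)) volume := (Lp.memLp f).integrable (by norm_num)
  have hae := Ω.isOpen.ae_eq_zero_of_integral_contDiff_smul_eq_zero (f := (f : E d → ℝ))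
    (μ := volume) hint.locallyIntegrableOn fun g hg hgc hgs => by
      have hg1 : ContDiff ℝ 1 g := hg.of_le (by exact_mod_cast le_top)
      have hgradc : HasCompactSupport (gradient g) :=
        hgc.mono' fun x hx => by
          by_contra h
          exact hx (gradient_eq_zero_of_notMem_tsupport h)
      have hm1 : MemLp g 2 (volume.restrict (Ω : Set (E d))) :=
        hg.continuous.memLp_of_hasCompactSupport hgc
      have hm2 : MemLp (gradient g) 2 (volume.restrict (Ω : Set (E d))) :=
        (continuous_gradient hg1).memLp_of_hasCompactSupport hgradc
      have h := hf (hm1.toLp g, hm2.toLp (gradient g))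
        (subset_closure ⟨g, hg, hgc, hgs, hm1.coeFn_toLp, hm2.coeFn_toLp⟩)
      rw [L2.inner_def] at h
      rw [← setIntegral_eq_integral_of_forall_compl_eq_zero (s := (Ω : Set (E d))), ← h]
      · refine integral_congr_ae ?_
        filter_upwards [hm1.coeFn_toLp] with x hx
        simp [hx]
      · intro x hx
        rw [image_eq_zero_of_notMem_tsupport fun h' => hx (hgs h'), zero_smul]
  refine Lp.eq_zero_iff_ae_eq_zero.2 ?_
  filter_upwards [ae_restrict_of_ae hae, ae_restrict_mem Ω.isOpen.measurableSet] with x h1 h2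
  exact h1 h2

theorem exists_dirichletEigenbasis (hΩ : Bornology.IsBounded (Ω : Set (E d))) :
    ∃ ι : Type, Countable ι ∧ Nonempty (Eigenbasis (sobolevSubmodule Ω) ι) := by
  obtain ⟨ι, ⟨e⟩⟩ := exists_eigenbasis (V := sobolevSubmodule Ω)
    (Submodule.isClosed_topologicalClosure _)
    (fun f hf => eq_zero_of_forall_inner_H10_eq_zero hΩ f fun p hp =>
      hf p (by rw [← SetLike.mem_coe, coe_sobolevSubmodule]; exact hp))
    (fun δ hδ => by
      obtain ⟨W, hW, h⟩ := exists_finiteDimensional_approximation hΩ hδ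
      exact ⟨W, hW, fun p hp => h p (by rw [← coe_sobolevSubmodule]; exact hp)⟩)
  have : Fact ((2 : ENNReal) ≠ ⊤) := ⟨by norm_num⟩
  exact ⟨ι, countable_of_orthonormal e.basis.orthonormal, ⟨e⟩⟩

theorem isDirichletEigenvalue_eigenvalue {ι : Type*} (e : Eigenbasis (sobolevSubmodule Ω) ι)
    (i : ι) : IsDirichletEigenvalue Ω (e.eigenvalue i) := by
  refine ⟨(e.basis i, e.grad i), ?_, e.basis.orthonormal.ne_zero i, fun q hq => ?_⟩
  · rw [← coe_sobolevSubmodule]; exact e.mem i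
  · rw [← coe_sobolevSubmodule] at hq
    exact e.inner_grad i q hq

/-- Test the eigenvalue equation with the eigenfunction itself and apply Poincaré's inequality. -/
theorem exists_pos_le_isDirichletEigenvalue (hd : 1 ≤ d)
    (hΩ : Bornology.IsBounded (Ω : Set (E d))) :
    ∃ m : ℝ, 0 < m ∧ ∀ l, IsDirichletEigenvalue Ω l → m ≤ l := by
  obtain ⟨C, hC, hle⟩ := exists_forall_mem_H10_norm_fst_le hd hΩ
  refine ⟨(C ^ 2)⁻¹, by positivity, ?_⟩
  rintro l ⟨p, hp, hp0, hl⟩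
  have h1 := hl p hp
  rw [real_inner_self_eq_norm_sq, real_inner_self_eq_norm_sq] at h1
  have h2 : ‖p.1‖ ^ 2 ≤ C ^ 2 * ‖p.2‖ ^ 2 := by
    rw [← mul_pow]
    exact pow_le_pow_left₀ (norm_nonneg _) (hle p hp) 2
  have h3 : 0 < ‖p.1‖ ^ 2 := by positivity
  rw [h1] at h2
  rw [inv_le_iff_one_le_mul₀ (by positivity)]
  refine le_of_mul_le_mul_right ?_ h3
  linarith

theorem firstEigenvalue_le (hd : 1 ≤ d) (hΩ : Bornology.IsBounded (Ω : Set (E d))) {l : ℝ}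
    (hl : IsDirichletEigenvalue Ω l) : firstEigenvalue Ω ≤ l := by
  obtain ⟨m, -, hm⟩ := exists_pos_le_isDirichletEigenvalue hd hΩ
  exact csInf_le ⟨m, hm⟩ hl

/-- The infimum of an empty set would be 0; a nonzero `y` forces the eigenbasis to be nonempty. -/
theorem firstEigenvalue_pos (hd : 1 ≤ d) (hΩ : Bornology.IsBounded (Ω : Set (E d)))
    {y : L2 Ω} (hy : y ≠ 0) : 0 < firstEigenvalue Ω := by
  obtain ⟨m, hm0, hm⟩ := exists_pos_le_isDirichletEigenvalue hd hΩ
  obtain ⟨ι, -, ⟨e⟩⟩ := exists_dirichletEigenbasis hΩ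
  have : Nonempty ι := by
    by_contra h
    rw [not_nonempty_iff] at h
    refine hy ?_
    rw [← norm_eq_zero, ← sq_eq_zero_iff]
    exact (e.hasSum_sq_coeff y).unique hasSum_empty
  exact hm0.trans_le (le_csInf ⟨_, isDirichletEigenvalue_eigenvalue e this.some⟩ hm)

/-- The source of the Lipschitz constant: waiting `a / (m r)` at decay rate `m` absorbs an excess
`a` over `r`, by `1 + x ≤ exp x` at `x = a / r`. -/
theorem exp_neg_mul_mul_le {m r a : ℝ} (hm : 0 < m) (hr : 0 < r) :
    Real.exp (-(m * (a / (m * r)))) * (r + a) ≤ r := by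
  have h1 : m * (a / (m * r)) = a / r := by field_simp
  have h2 := Real.add_one_le_exp (a / r)
  rw [h1, Real.exp_neg, inv_mul_le_iff₀ (Real.exp_pos _)]
  calc r + a = (a / r + 1) * r := by field_simp; ring
    _ ≤ _ := by gcongr

/-! ### Controls and their truncation -/

section Control

variable (ω : Opens (E d))

theorem chiMul_coeFn (f : L2 Ω) :
    (chiMul ω f : E d → ℝ) =ᵐ[volume.restrict (Ω : Set (E d))] (ω : Set (E d)).indicator f :=
  MemLp.coeFn_toLp _

theorem chiMul_zero : chiMul ω (0 : L2 Ω) = 0 := by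
  refine Lp.eq_zero_iff_ae_eq_zero.2 ?_
  filter_upwards [chiMul_coeFn ω (0 : L2 Ω),
    Lp.coeFn_zero ℝ 2 (volume.restrict (Ω : Set (E d)))] with x h1 h2
  classical
  rw [h1, indicator_apply, h2]
  simp

/-- Gives both measurability and square integrability of the source `χ_ω u`. -/
theorem lipschitzWith_chiMul : LipschitzWith 1 (chiMul ω : L2 Ω → L2 Ω) := by
  refine LipschitzWith.of_dist_le' (K := 1) (fun f g => ?_) |>.weaken (by simp)
  rw [dist_eq_norm, dist_eq_norm, one_mul]
  refine Lp.norm_le_norm_of_ae_le ?_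
  filter_upwards [chiMul_coeFn ω f, chiMul_coeFn ω g, Lp.coeFn_sub (chiMul ω f) (chiMul ω g),
    Lp.coeFn_sub f g] with x h1 h2 h3 h4
  rw [h3, h4, Pi.sub_apply, Pi.sub_apply, h1, h2]
  by_cases hx : x ∈ (ω : Set (E d)) <;> simp [hx]

theorem memLp_chiMul (u : Control Ω) :
    MemLp (fun s => chiMul ω (u s)) 2 (volume.restrict (Ioi (0 : ℝ))) :=
  (lipschitzWith_chiMul ω).comp_memLp (chiMul_zero ω) (Lp.memLp u)

/-- A control can be switched off at a given time. -/
theorem exists_truncated_control (u : Control Ω) (t : ℝ) :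
    ∃ v : Control Ω, ‖v‖ ≤ ‖u‖ ∧
      (∀ᵐ s ∂volume.restrict (Ioc 0 t), v s = u s) ∧
      ∀ᵐ s ∂volume.restrict (Ioi (0 : ℝ)), t < s → v s = 0 := by
  have hm := (Lp.memLp u).indicator (measurableSet_Iic (a := t))
  refine ⟨hm.toLp _, Lp.norm_le_norm_of_ae_le ?_, ?_, ?_⟩
  · filter_upwards [hm.coeFn_toLp] with s hs
    rw [hs]
    exact norm_indicator_le_norm_self _ _
  · filter_upwards [ae_restrict_of_ae_restrict_of_subset Ioc_subset_Ioi_self hm.coeFn_toLp,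
      ae_restrict_mem measurableSet_Ioc] with s hs hst
    rw [hs]
    exact indicator_of_mem (s := Iic t) hst.2 _
  · filter_upwards [hm.coeFn_toLp] with s hs hst
    rw [hs]
    exact indicator_of_notMem (s := Iic t) (not_le.2 hst) _

end Control

/-! ### Hitting times and the minimal time -/

section MinimalTime

variable {ω : Opens (E d)} {r M : ℝ}

theorem isHeatSolution_iff {y₀ : L2 Ω} {F y : ℝ → L2 Ω} :
    IsHeatSolution Ω y₀ F y ↔
      IsWeakSolution (sobolevSubmodule Ω : Set (L2 Ω × L2Vec Ω)) y₀ F y := by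
  rw [coe_sobolevSubmodule]; rfl

variable {ι : Type*} [Countable ι] (e : Eigenbasis (sobolevSubmodule Ω) ι)

theorem isHeatSolution_freeState (y₀ : L2 Ω) :
    IsHeatSolution Ω y₀ (fun _ => 0) (e.freeState y₀) :=
  isHeatSolution_iff.2 (e.isWeakSolution_freeState (Submodule.isClosed_topologicalClosure _) y₀)

theorem freeTimesOutside_eq (y₀ : L2 Ω) :
    freeTimesOutside Ω r y₀ = {t | 0 < t ∧ r < ‖e.freeState y₀ t‖} := by
  ext t
  simp only [freeTimesOutside, mem_ofPred_eq, mem_closedBall_zero_iff, not_le]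
  refine and_congr_right fun ht => ⟨?_, fun h => ⟨_, isHeatSolution_freeState e y₀, h⟩⟩
  rintro ⟨y, hy, h⟩
  rwa [e.eq_freeState_of_isWeakSolution (by simp) (isHeatSolution_iff.1 hy) ht.le] at h

theorem mem_hittingTimes_of_norm_freeState_le (hM : 0 ≤ M) {y₀ : L2 Ω} {t : ℝ} (ht : 0 < t)
    (h : ‖e.freeState y₀ t‖ ≤ r) : t ∈ hittingTimes Ω ω r M y₀ := by
  refine ⟨ht, 0, by simpa using hM, _, isHeatSolution_iff.2 ((isHeatSolution_iff.1
    (isHeatSolution_freeState e y₀)).congr_ae ?_), mem_closedBall_zero_iff.2 h⟩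
  filter_upwards [Lp.coeFn_zero (L2 Ω) 2 (volume.restrict (Ioi (0 : ℝ)))] with s hs
  rw [hs, Pi.zero_apply, chiMul_zero]

theorem hittingTimes_zero_eq (y₀ : L2 Ω) :
    hittingTimes Ω ω r 0 y₀ = {t | 0 < t ∧ ‖e.freeState y₀ t‖ ≤ r} := by
  ext t
  refine ⟨?_, fun h => mem_hittingTimes_of_norm_freeState_le e le_rfl h.1 h.2⟩
  rintro ⟨ht, u, hu, y, hy, h⟩
  have hu0 : u = 0 := norm_le_zero_iff.1 hu
  refine ⟨ht, ?_⟩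
  rw [← e.eq_freeState_of_isWeakSolution ?_ (isHeatSolution_iff.1 hy) ht.le]
  · exact mem_closedBall_zero_iff.1 h
  · filter_upwards [Lp.coeFn_zero (L2 Ω) 2 (volume.restrict (Ioi (0 : ℝ)))] with s hs
    rw [hu0, hs, Pi.zero_apply, chiMul_zero]

theorem nonempty_hittingTimes {m : ℝ} (hm0 : 0 < m) (hm : ∀ i, m ≤ e.eigenvalue i) (hr : 0 < r)
    (hM : 0 ≤ M) {y₀ : L2 Ω} (hy₀ : y₀ ≠ 0) : (hittingTimes Ω ω r M y₀).Nonempty := by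
  have hn : 0 < ‖y₀‖ := norm_pos_iff.2 hy₀
  have ht : 0 < ‖y₀‖ / (m * r) := by positivity
  refine ⟨_, mem_hittingTimes_of_norm_freeState_le e hM ht ?_⟩
  refine (e.norm_freeState_le y₀ ht.le hm).trans (le_trans ?_ (exp_neg_mul_mul_le hm0 hr (a := ‖y₀‖)))
  gcongr
  linarith

theorem nonempty_freeTimesOutside {ι : Type*} [Countable ι] (e : Eigenbasis (sobolevSubmodule Ω) ι)
    {y₀ : L2 Ω} (hy₀ : r < ‖y₀‖) :
    (freeTimesOutside Ω r y₀).Nonempty := by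
  rw [freeTimesOutside_eq e]
  have hc := ((e.continuousOn_freeState y₀).norm 0 self_mem_Ici).mono Ioi_subset_Ici_self
  have h0 : r < ‖e.freeState y₀ 0‖ := by rwa [e.freeState_zero]
  have := (hc.eventually (lt_mem_nhds h0)).and self_mem_nhdsWithin
  obtain ⟨t, h1, h2⟩ := this.exists
  exact ⟨t, h2, h1⟩

/-- By time `‖y₀‖ / (m r)` the free state is in the ball, and its norm cannot grow again. -/
theorem bddAbove_freeTimesOutside {m : ℝ} (hm0 : 0 < m) (hm : ∀ i, m ≤ e.eigenvalue i)
    (hr : 0 < r) (y₀ : L2 Ω) : BddAbove (freeTimesOutside Ω r y₀) := by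
  rw [freeTimesOutside_eq e]
  refine ⟨‖y₀‖ / (m * r), fun t ht => ?_⟩
  by_contra! hlt
  have h0 : 0 ≤ ‖y₀‖ / (m * r) := by positivity
  have h1 := e.norm_freeState_antitone y₀ h0 hlt.le
  have h2 := e.norm_freeState_le y₀ h0 hm
  have h3 := exp_neg_mul_mul_le hm0 hr (a := ‖y₀‖)
  have h4 := Real.exp_pos (-(m * (‖y₀‖ / (m * r))))
  nlinarith [ht.2]

/-- The core comparison: reuse the control up to `t`, then let the state decay freely for the extra
time. -/
theorem add_mem_hittingTimes {m : ℝ} (hm0 : 0 < m) (hm : ∀ i, m ≤ e.eigenvalue i)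
    (hr : 0 < r) {y₁ y₂ : L2 Ω} {t : ℝ} (ht : t ∈ hittingTimes Ω ω r M y₁) :
    t + ‖y₂ - y₁‖ / (m * r) ∈ hittingTimes Ω ω r M y₂ := by
  obtain ⟨ht0, u, hu, y, hy, hyt⟩ := ht
  obtain ⟨v, hv, hv1, hv2⟩ := exists_truncated_control u t
  set τ := ‖y₂ - y₁‖ / (m * r) with hτ
  have hτ0 : 0 ≤ τ := by positivity
  have hadd := (isHeatSolution_iff.1 hy).add_homogeneous
    (isHeatSolution_iff.1 (isHeatSolution_freeState e (y₂ - y₁)))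
  rw [add_sub_cancel] at hadd
  set z := y t + e.freeState (y₂ - y₁) t with hz
  have hsol := hadd.concat (F' := fun s => chiMul ω (v s)) ht0
    (isHeatSolution_iff.1 (isHeatSolution_freeState e z)) ?_ ?_ ?_
  · refine ⟨by positivity, v, hv.trans hu, _, isHeatSolution_iff.2 hsol, ?_⟩
    have hval : (if t + τ ≤ t then y (t + τ) + e.freeState (y₂ - y₁) (t + τ)
        else e.freeState z (t + τ - t)) = e.freeState z τ := by
      -- The first branch occurs only when `τ = 0`, that is, with no waiting time.
      split_ifs with h
      · have : τ = 0 := by linarith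
        rw [this, add_zero, e.freeState_zero]
      · rw [add_sub_cancel_left]
    have hz1 : ‖z‖ ≤ r + ‖y₂ - y₁‖ := by
      refine (norm_add_le _ _).trans (add_le_add (mem_closedBall_zero_iff.1 hyt) ?_)
      have := e.norm_freeState_antitone (y₂ - y₁) le_rfl ht0.le
      rwa [e.freeState_zero] at this
    rw [mem_closedBall_zero_iff]
    change ‖if t + τ ≤ t then y (t + τ) + e.freeState (y₂ - y₁) (t + τ)
        else e.freeState z (t + τ - t)‖ ≤ r
    rw [hval]
    refine (e.norm_freeState_le z hτ0 hm).trans (le_trans ?_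
      (exp_neg_mul_mul_le hm0 hr (a := ‖y₂ - y₁‖)))
    gcongr
  · filter_upwards [hv1] with s hs
    rw [hs]
  · exact ((memLp_chiMul ω u).mono_measure
      (Measure.restrict_mono Ioc_subset_Ioi_self le_rfl)).integrable (by norm_num)
  · filter_upwards [ae_restrict_of_ae_restrict_of_subset (Ioi_subset_Ioi ht0.le) hv2,
      ae_restrict_mem measurableSet_Ioi] with s hs hst
    rw [hs hst, chiMul_zero]

theorem minTime_le_minTime_add {m : ℝ} (hm0 : 0 < m) (hm : ∀ i, m ≤ e.eigenvalue i)
    (hr : 0 < r) {y₁ y₂ : L2 Ω} (hne : (hittingTimes Ω ω r M y₁).Nonempty) :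
    minTime Ω ω r M y₂ ≤ minTime Ω ω r M y₁ + ‖y₂ - y₁‖ / (m * r) := by
  rw [← sub_le_iff_le_add]
  refine le_csInf hne fun t ht => ?_
  rw [sub_le_iff_le_add]
  exact csInf_le ⟨0, fun s hs => hs.1.le⟩ (add_mem_hittingTimes e hm0 hm hr ht)

/-- With zero control the two sets of times are complementary in `(0, ∞)`, and monotonicity of the
norm puts one below the other, so supremum and infimum meet. -/
theorem minTime_zero_eq_freeTime {ι : Type*} [Countable ι] (e : Eigenbasis (sobolevSubmodule Ω) ι)
    {y₀ : L2 Ω} (hne : (hittingTimes Ω ω r 0 y₀).Nonempty)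
    (hne' : (freeTimesOutside Ω r y₀).Nonempty) (hbdd : BddAbove (freeTimesOutside Ω r y₀)) :
    minTime Ω ω r 0 y₀ = freeTime Ω r y₀ := by
  rw [minTime, freeTime]
  refine le_antisymm (le_of_forall_gt_imp_ge_of_dense fun t ht => ?_) ?_
  · obtain ⟨s, hs⟩ := hne'
    have ht0 : 0 < t := hs.1.trans_le ((le_csSup hbdd hs).trans ht.le)
    refine csInf_le ⟨0, fun s hs => hs.1.le⟩ ?_
    rw [hittingTimes_zero_eq e]
    refine ⟨ht0, le_of_not_gt fun hlt => ?_⟩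
    have : t ∈ freeTimesOutside Ω r y₀ := by
      rw [freeTimesOutside_eq e]; exact ⟨ht0, hlt⟩
    exact (le_csSup hbdd this).not_gt ht
  · refine csSup_le hne' fun s hs => le_csInf hne fun t ht => le_of_not_gt fun hlt => ?_
    rw [freeTimesOutside_eq e] at hs
    rw [hittingTimes_zero_eq e] at ht
    exact absurd ((e.norm_freeState_antitone y₀ ht.1.le hlt.le).trans ht.2) (not_le.2 hs.2)

end MinimalTime

end DirichletLaplacian

end HeatTimeOptimal

/-! ### The main theorem -/

theorem mainTheorem12 (d : ℕ) (hd : 1 ≤ d)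
    (Ω : TopologicalSpace.Opens (HeatTimeOptimal.E d))
    (hΩ : HeatTimeOptimal.IsBoundedC2Domain Ω)
    (ω : TopologicalSpace.Opens (HeatTimeOptimal.E d))
    (hω : (ω : Set (HeatTimeOptimal.E d)).Nonempty) (hωΩ : ω ≤ Ω)
    (r : ℝ) (hr : 0 < r) :
    -- `T(M, y₀)` and `T*_{y₀}` are well defined and finite
    (∀ y₀ : HeatTimeOptimal.L2 Ω, y₀ ∉ Metric.closedBall (0 : HeatTimeOptimal.L2 Ω) r →
      (∀ M : ℝ, 0 ≤ M → (HeatTimeOptimal.hittingTimes Ω ω r M y₀).Nonempty) ∧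
      (HeatTimeOptimal.freeTimesOutside Ω r y₀).Nonempty ∧
      BddAbove (HeatTimeOptimal.freeTimesOutside Ω r y₀)) ∧
    -- Lipschitz dependence on the initial state
    (∀ M : ℝ, 0 ≤ M → ∀ y₁ y₂ : HeatTimeOptimal.L2 Ω,
      y₁ ∉ Metric.closedBall (0 : HeatTimeOptimal.L2 Ω) r →
      y₂ ∉ Metric.closedBall (0 : HeatTimeOptimal.L2 Ω) r →
      |HeatTimeOptimal.minTime Ω ω r M y₁ - HeatTimeOptimal.minTime Ω ω r M y₂| ≤
        1 / (HeatTimeOptimal.firstEigenvalue Ω * r) * ‖y₁ - y₂‖) ∧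
    -- the minimal time without control
    (∀ y₀ : HeatTimeOptimal.L2 Ω, y₀ ∉ Metric.closedBall (0 : HeatTimeOptimal.L2 Ω) r →
      HeatTimeOptimal.minTime Ω ω r 0 y₀ = HeatTimeOptimal.freeTime Ω r y₀) := by
  obtain ⟨ι, _, ⟨e⟩⟩ := HeatTimeOptimal.exists_dirichletEigenbasis hΩ.isBounded
  have hlt : ∀ y : HeatTimeOptimal.L2 Ω, y ∉ Metric.closedBall (0 : HeatTimeOptimal.L2 Ω) r →
      r < ‖y‖ := fun y hy => by simpa using hy
  have hne : ∀ y : HeatTimeOptimal.L2 Ω, y ∉ Metric.closedBall (0 : HeatTimeOptimal.L2 Ω) r →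
      y ≠ 0 := fun y hy => norm_pos_iff.1 (hr.trans (hlt y hy))
  -- A state outside the ball is the nonzero vector that positivity of `λ₁` requires.
  have hpos : ∀ y : HeatTimeOptimal.L2 Ω, y ∉ Metric.closedBall (0 : HeatTimeOptimal.L2 Ω) r →
      0 < HeatTimeOptimal.firstEigenvalue Ω := fun y hy =>
    HeatTimeOptimal.firstEigenvalue_pos hd hΩ.isBounded (hne y hy)
  have hle : ∀ i, HeatTimeOptimal.firstEigenvalue Ω ≤ e.eigenvalue i := fun i =>
    HeatTimeOptimal.firstEigenvalue_le hd hΩ.isBounded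
      (HeatTimeOptimal.isDirichletEigenvalue_eigenvalue e i)
  have hhit : ∀ y : HeatTimeOptimal.L2 Ω, y ∉ Metric.closedBall (0 : HeatTimeOptimal.L2 Ω) r →
      ∀ M : ℝ, 0 ≤ M → (HeatTimeOptimal.hittingTimes Ω ω r M y).Nonempty := fun y hy M hM =>
    HeatTimeOptimal.nonempty_hittingTimes e (hpos y hy) hle hr hM (hne y hy)
  refine ⟨fun y hy => ⟨hhit y hy, HeatTimeOptimal.nonempty_freeTimesOutside e (hlt y hy),
    HeatTimeOptimal.bddAbove_freeTimesOutside e (hpos y hy) hle hr y⟩,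
    fun M hM y₁ y₂ hy₁ hy₂ => ?_, fun y hy => ?_⟩
  · have h1 := HeatTimeOptimal.minTime_le_minTime_add (y₂ := y₂) e (hpos y₁ hy₁) hle hr
      (hhit y₁ hy₁ M hM)
    have h2 := HeatTimeOptimal.minTime_le_minTime_add (y₂ := y₁) e (hpos y₁ hy₁) hle hr
      (hhit y₂ hy₂ M hM)
    rw [norm_sub_rev] at h1
    rw [one_div_mul_eq_div, abs_sub_le_iff]
    constructor <;> linarith
  · exact HeatTimeOptimal.minTime_zero_eq_freeTime e (hhit y hy 0 le_rfl)
      (HeatTimeOptimal.nonempty_freeTimesOutside e (hlt y hy))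
      (HeatTimeOptimal.bddAbove_freeTimesOutside e (hpos y hy) hle hr y)
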